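/- **Conventions.** $\lambda$ is the security parameter. A function $f$ is negligible, $f=\mathrm{negl}(\lambda)$, if for every $c\in\mathbb N$, $|f(\lambda)|<\lambda^{-c}$ for all large $\lambda$. PPT (QPT) algorithms are families of randomized classical (quantum) circuits of size $\mathrm{poly}(\lambda)$. For $\mathsf{pp}$, a distribution $\mathcal D_{\mathsf{pp}}$ on $\{0,1\}^n$ and a function $F_{\mathsf{pp}}:\{0,1\}\times\{0,1\}^n\to\{0,1\}^m$, put $$w_{\mathsf{pp},y,d,b}=\sum_{x:\,F_{\mathsf{pp}}(b,x)=y}(-1)^{d\cdot x}\sqrt{\mathcal D_{\mathsf{pp}}(x)},\qquad \widetilde w_{\mathsf{pp},y,d,b}=\frac{w_{\mathsf{pp},y,d,b}}{\sqrt{w_{\mathsf{pp},y,d,0}^2+w_{\mathsf{pp},y,d,1}^2}},$$ and let $\mathcal P_{\mathsf{pp},y}$ be the distribution on $d\in\{0,1\}^n$ with probabilities proportional to $w_{\mathsf{pp},y,d,0}^2+w_{\mathsf{pp},y,d,1}^2$ (the distribution of the outcome when, starting from $\frac1{\sqrt2}\sum_{b,x}\sqrt{\mathcal D_{\mathsf{pp}}(x)}|b\rangle|x\rangle$,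 one measures the value $y$ of $F_{\mathsf{pp}}(b,x)$ and then the register of $x$ in the Hadamard basis). **Definition.** A *dual-mode trapdoor claw-free function (dTCF) with efficient phase computation* consists of a PPT algorithm $\mathsf{Gen}(1^\lambda,\mu)\to(\mathsf{pp},\mathsf{sp})$ with a mode bit $\mu\in\{0,1\}$, functions $F_{\mathsf{pp}}:\{0,1\}\times\{0,1\}^{n(\lambda)}\to\{0,1\}^{m(\lambda)}$ computable in polynomial time from $\mathsf{pp}$ and the argument, distributions $\mathcal D_{\mathsf{pp}}$ on $\{0,1\}^{n(\lambda)}$, and PPT algorithms $\mathsf{PartialInvert}(\mathsf{sp},y)$ (whose output is a subset of $\{0,1\}$) and $\mathsf{PhaseInvert}(\mathsf{sp},y,d)$ (whose output is a bit), such that: * *Efficient state preparation.* A QPT algorithm, given any $\mathsf{pp}$ that $\mathsf{Gen}(1^\lambda,\mu)$ can output, $\mu\in\{0,1\}$, outputs a state within negligible trace distance of $\sum_x\sqrt{\mathcal D_{\mathsf{pp}}(x)}|x\rangle$. * *Efficient partial inversion.* For all $\mu,b\in\{0,1\}$, if $(\mathsf{pp},\mathsf{sp})\leftarrow\mathsf{Gen}(1^\lambda,\mu)$,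 $x\leftarrow\mathcal D_{\mathsf{pp}}$ and $y=F_{\mathsf{pp}}(b,x)$, then $\mathsf{PartialInvert}(\mathsf{sp},y)=\{b':\exists x',\ F_{\mathsf{pp}}(b',x')=y\}$ with probability $1-\mathrm{negl}(\lambda)$. * *Disjoint mode.* For each $b\in\{0,1\}$, if $(\mathsf{pp},\mathsf{sp})\leftarrow\mathsf{Gen}(1^\lambda,0)$, $x\leftarrow\mathcal D_{\mathsf{pp}}$ and $y=F_{\mathsf{pp}}(b,x)$, then $\Pr[\exists x',\ F_{\mathsf{pp}}(1-b,x')=y]=\mathrm{negl}(\lambda)$. * *Lossy mode.* There is a negligible $\nu$ such that, if $(\mathsf{pp},\mathsf{sp})\leftarrow\mathsf{Gen}(1^\lambda,1)$, $b\leftarrow\{0,1\}$ is uniform, $x\leftarrow\mathcal D_{\mathsf{pp}}$, $y=F_{\mathsf{pp}}(b,x)$, $d\leftarrow\mathcal P_{\mathsf{pp},y}$ and $s\leftarrow\mathsf{PhaseInvert}(\mathsf{sp},y,d)$, then $|\widetilde w_{\mathsf{pp},y,d,0}-(-1)^s\widetilde w_{\mathsf{pp},y,d,1}|\le\nu(\lambda)$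 with probability $1-\mathrm{negl}(\lambda)$. * *Mode indistinguishability.* For every QPT family $\{\mathsf{Adv}_\lambda\}$, the probabilities that $\mathsf{Adv}_\lambda(\mathsf{pp})=1$ for $(\mathsf{pp},\mathsf{sp})\leftarrow\mathsf{Gen}(1^\lambda,0)$ and for $(\mathsf{pp},\mathsf{sp})\leftarrow\mathsf{Gen}(1^\lambda,1)$ differ by $\mathrm{negl}(\lambda)$. **Definition.** A *two-round oblivious state preparation (OSP)* protocol consists of a PPT algorithm $\mathsf{Sen}(1^\lambda,b)\to(\mathsf{msg}_S,\mathsf{st}_S)$, a QPT algorithm $\mathsf{Rec}(\mathsf{msg}_S)\to(|\psi\rangle,\mathsf{msg}_R)$, where $|\psi\rangle$ is a qubit and $\mathsf{msg}_R$ is classical, and a PPT algorithm $\mathsf{Dec}(\mathsf{st}_S,\mathsf{msg}_R)\to s\in\{0,1\}$, such that: * *Correctness.* With $\Pi_b=\sum_{s\in\{0,1\}}|s\rangle\langle s|\otimes H^b|s\rangle\langle s|H^b$, for each $b\in\{0,1\}$ the expectation of $\|\Pi_b|s\rangle|\psi\rangle\|$ over an honest execution with sender input $b$ is $1-\mathrm{negl}(\lambda)$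 (if the qubit is in a mixed state $\rho$, the norm is read as $\sqrt{\mathrm{Tr}(\Pi_b(|s\rangle\langle s|\otimes\rho))}$). * *Security.* For every QPT family $\{\mathsf{Adv}_\lambda\}$ that takes part in the protocol as the receiver and outputs a bit, the probabilities of the output $0$ for the sender inputs $b=0$ and $b=1$ differ by $\mathrm{negl}(\lambda)$. **Theorem.** If there is a dTCF with efficient phase computation, then there is a two-round OSP protocol. -/

import Mathlib

/-! ### Asymptotics -/

/-- `f` is negligible: `|f n| < n ^ (-c)` for every `c` and all large `n`. -/
def Negligible (f : ℕ → ℝ) : Prop :=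
  ∀ c : ℕ, ∃ N : ℕ, ∀ n : ℕ, N < n → |f n| < ((n : ℝ) ^ c)⁻¹

/-- `f` is `poly(n)`: `f n < n ^ c` for some `c` and all large `n`. -/
def PolyBounded (f : ℕ → ℕ) : Prop :=
  ∃ c N : ℕ, ∀ n : ℕ, N < n → f n < n ^ c

/-- Bit strings whose positions are labelled by `ι`. -/
abbrev Bits (ι : Type) : Type := ι → Bool

/-- The indicator of an event. -/
noncomputable def ind (p : Prop) : ℝ := open Classical in if p then 1 else 0

/-! ### Classical circuits -/

/-- A gate of a Boolean circuit with input wires `ι`. The wire `Sum.inl i` is the `i`-th input, and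
the wire `Sum.inr k` is the output of the `k`-th gate. -/
inductive BGate (ι : Type) : Type
  | const (b : Bool) : BGate ι
  | not (i : ι ⊕ ℕ) : BGate ι
  | and (i j : ι ⊕ ℕ) : BGate ι
  | xor (i j : ι ⊕ ℕ) : BGate ι

/-- The value of a wire, given the input and the list of the gate outputs computed so far
(a wire that does not carry a value yet is read as `0`). -/
def wireValue {ι : Type} (x : Bits ι) (vals : List Bool) : ι ⊕ ℕ → Bool
  | Sum.inl i => x i
  | Sum.inr k => vals.getD k false

/-- The output of a single gate. -/
def BGate.eval {ι : Type} (x : Bits ι) (vals : List Bool) : BGate ι → Bool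
  | .const b => b
  | .not i => !(wireValue x vals i)
  | .and i j => wireValue x vals i && wireValue x vals j
  | .xor i j => Bool.xor (wireValue x vals i) (wireValue x vals j)

/-- A Boolean circuit with input wires `ι` and output positions `κ`. -/
structure BCirc (ι κ : Type) : Type where
  gates : List (BGate ι)
  out : κ → ι ⊕ ℕ

/-- The list of all gate outputs, the gates being evaluated in order. -/
def BCirc.run {ι κ : Type} (C : BCirc ι κ) (x : Bits ι) : List Bool :=
  C.gates.foldl (fun vals g => vals ++ [g.eval x vals]) []

/-- The function computed by a Boolean circuit. -/
def BCirc.eval {ι κ : Type} (C : BCirc ι κ) (x : Bits ι) : Bits κ :=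
  fun j => wireValue x (C.run x) (C.out j)

/-- The size of a circuit: inputs, gates and outputs. -/
def BCirc.size {ι κ : Type} [Fintype ι] [Fintype κ] (C : BCirc ι κ) : ℕ :=
  Fintype.card ι + C.gates.length + Fintype.card κ

/-- A randomized classical circuit: a Boolean circuit with `coins` additional input bits, which
are uniformly random. -/
structure RCirc (ι κ : Type) : Type where
  coins : ℕ
  circ : BCirc (ι ⊕ Fin coins) κ

/-- The output on input `x` and random coins `r`. -/
def RCirc.eval {ι κ : Type} (C : RCirc ι κ) (x : Bits ι) (r : Bits (Fin C.coins)) : Bits κ :=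
  C.circ.eval (Sum.elim x r)

/-- `C.expect x g` is the expectation of `g z` over `z ← C(x)`. -/
noncomputable def RCirc.expect {ι κ : Type} (C : RCirc ι κ) (x : Bits ι) (g : Bits κ → ℝ) : ℝ :=
  (∑ r : Bits (Fin C.coins), g (C.eval x r)) / 2 ^ C.coins

/-- The size of a randomized circuit. -/
def RCirc.size {ι κ : Type} [Fintype ι] [Fintype κ] (C : RCirc ι κ) : ℕ := C.circ.size

/-! ### Quantum circuits -/

/-- Gates on qubits labelled by `W`: the universal gate set consisting of Hadamard, `T`, NOT, CNOT
(control `c`, target `t`) and Toffoli (controls `a`, `b`, target `t`). -/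
inductive QGate (W : Type) : Type
  | hadamard (i : W) : QGate W
  | tgate (i : W) : QGate W
  | not (i : W) : QGate W
  | cnot (c t : W) (h : c ≠ t) : QGate W
  | toffoli (a b t : W) (ha : a ≠ t) (hb : b ≠ t) : QGate W

/-- The action of a gate on a vector of amplitudes. -/
noncomputable def QGate.act {W : Type} [DecidableEq W] :
    QGate W → (Bits W → ℂ) → (Bits W → ℂ)
  | .hadamard i, ψ => fun z =>
      (ψ (Function.update z i false) + (if z i then -1 else 1) * ψ (Function.update z i true))
        / (Real.sqrt 2 : ℂ)
  | .tgate i, ψ => fun z =>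
      (if z i then Complex.exp (Complex.I * (Real.pi / 4 : ℂ)) else 1) * ψ z
  | .not i, ψ => fun z => ψ (Function.update z i (!(z i)))
  | .cnot c t _, ψ => fun z => ψ (Function.update z t (Bool.xor (z t) (z c)))
  | .toffoli a b t _ _, ψ => fun z => ψ (Function.update z t (Bool.xor (z t) (z a && z b)))

/-- A quantum circuit with classical input wires `ι` and output wires `κ`. It acts on the input wires
and on `anc` ancillas initialized to `|0⟩`; at the end its wires are split into the output wires
and `gar` discarded wires. (Intermediate measurements are covered, since they can be deferred.) -/
structure QCirc (ι κ : Type) : Type where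
  anc : ℕ
  gar : ℕ
  gates : List (QGate (ι ⊕ Fin anc))
  wires : ι ⊕ Fin anc ≃ κ ⊕ Fin gar

/-- The size of a quantum circuit: wires and gates. -/
def QCirc.size {ι κ : Type} [Fintype ι] (C : QCirc ι κ) : ℕ :=
  Fintype.card ι + C.anc + C.gates.length

/-- The state vector at the end of the circuit on classical input `x`. -/
noncomputable def QCirc.final {ι κ : Type} [Fintype ι] [DecidableEq ι] (C : QCirc ι κ)
    (x : Bits ι) : Bits (ι ⊕ Fin C.anc) → ℂ :=
  C.gates.foldl (fun ψ g => g.act ψ)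
    (fun z => if z = Sum.elim x (fun _ => false) then 1 else 0)

/-- The density matrix of the output wires on classical input `x` (the other wires being traced
out). -/
noncomputable def QCirc.density {ι κ : Type} [Fintype ι] [DecidableEq ι] (C : QCirc ι κ)
    (x : Bits ι) : Matrix (Bits κ) (Bits κ) ℂ :=
  Matrix.of fun z z' => ∑ g : Bits (Fin C.gar),
    C.final x (Sum.elim z g ∘ C.wires) * star (C.final x (Sum.elim z' g ∘ C.wires))

/-- The probability that measuring the output wires in the computational basis gives `z`. -/
noncomputable def QCirc.prob {ι κ : Type} [Fintype ι] [DecidableEq ι] (C : QCirc ι κ)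
    (x : Bits ι) (z : Bits κ) : ℝ := (C.density x z z).re

/-- The trace norm `Tr √(A† A)`, i.e. the sum of the square roots of the eigenvalues of `A† A`. -/
noncomputable def traceNorm {α : Type} [Fintype α] [DecidableEq α] (A : Matrix α α ℂ) : ℝ :=
  ∑ i, Real.sqrt ((Matrix.isHermitian_conjTranspose_mul_self A).eigenvalues i)

/-- The trace distance of two density matrices. -/
noncomputable def traceDist {α : Type} [Fintype α] [DecidableEq α] (ρ σ : Matrix α α ℂ) : ℝ :=
  traceNorm (ρ - σ) / 2

/-! ### Two-round oblivious state preparation -/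

/-- The three algorithms of a two-message protocol between a PPT sender with an input bit and a QPT
receiver. The sender outputs `(msgS, st)`; the receiver gets `msgS`, returns the message `msgR`
(the measured wires `Sum.inr _`) and keeps one qubit (the wire `Sum.inl ()`); finally the sender
computes a bit from `st` and `msgR`. -/
structure TwoRoundProtocol : Type where
  lenS : ℕ → ℕ
  lenSt : ℕ → ℕ
  lenR : ℕ → ℕ
  sen : ∀ lam, RCirc Unit (Fin (lenS lam) ⊕ Fin (lenSt lam))
  rcv : ∀ lam, QCirc (Fin (lenS lam)) (Unit ⊕ Fin (lenR lam))
  dec : ∀ lam, RCirc (Fin (lenSt lam) ⊕ Fin (lenR lam)) Unit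
  sen_ppt : PolyBounded fun lam => (sen lam).size
  rcv_qpt : PolyBounded fun lam => (rcv lam).size
  dec_ppt : PolyBounded fun lam => (dec lam).size

/-- `|s⟩⟨s|`. -/
def ketbra (s : Bool) : Matrix Bool Bool ℂ := Matrix.single s s 1

/-- The Hadamard matrix. -/
noncomputable def hadamardMatrix : Matrix Bool Bool ℂ :=
  Matrix.of fun c c' => (if c && c' then -1 else 1) / (Real.sqrt 2 : ℂ)

/-- `Π_{OSP,b} = ∑ s, |s⟩⟨s| ⊗ H^b |s⟩⟨s| H^b`. -/
noncomputable def projOSP (b : Bool) : Matrix (Bool × Bool) (Bool × Bool) ℂ :=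
  ∑ s : Bool, Matrix.kronecker (ketbra s)
    (hadamardMatrix ^ b.toNat * ketbra s * hadamardMatrix ^ b.toNat)

/-- The overlap `√ Tr (Π_{OSP,b} (|s⟩⟨s| ⊗ ρ))`, which is `‖Π_{OSP,b} |s⟩|ψ⟩‖` when the qubit is in
the pure state `ρ = |ψ⟩⟨ψ|`. -/
noncomputable def overlapOSP (b s : Bool) (ρ : Matrix Bool Bool ℂ) : ℝ :=
  Real.sqrt (Matrix.trace (projOSP b * Matrix.kronecker (ketbra s) ρ)).re

namespace TwoRoundProtocol

/-- The expectation of `g msgS st` over the output of the sender on input `b`. -/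
noncomputable def senExpect (P : TwoRoundProtocol) (lam : ℕ) (b : Bool)
    (g : Bits (Fin (P.lenS lam)) → Bits (Fin (P.lenSt lam)) → ℝ) : ℝ :=
  (P.sen lam).expect (fun _ => b) fun o => g (o ∘ Sum.inl) (o ∘ Sum.inr)

/-- The unnormalized state of the receiver's qubit when its message is `r`. -/
noncomputable def branch (P : TwoRoundProtocol) (lam : ℕ) (msgS : Bits (Fin (P.lenS lam)))
    (r : Bits (Fin (P.lenR lam))) : Matrix Bool Bool ℂ :=
  Matrix.of fun c c' =>
    (P.rcv lam).density msgS (Sum.elim (fun _ => c) r) (Sum.elim (fun _ => c') r)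

/-- The probability that the receiver's message is `r`. -/
noncomputable def branchProb (P : TwoRoundProtocol) (lam : ℕ) (msgS : Bits (Fin (P.lenS lam)))
    (r : Bits (Fin (P.lenR lam))) : ℝ :=
  (Matrix.trace (P.branch lam msgS r)).re

/-- The expected overlap at the end of an honest execution with sender input `b`. -/
noncomputable def honestOverlap (P : TwoRoundProtocol) (lam : ℕ) (b : Bool) : ℝ :=
  P.senExpect lam b fun msgS st =>
    ∑ r : Bits (Fin (P.lenR lam)), P.branchProb lam msgS r *
      (P.dec lam).expect (Sum.elim st r) fun s =>
        overlapOSP b (s ()) (((P.branchProb lam msgS r : ℂ))⁻¹ • P.branch lam msgS r)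

/-- Correctness of OSP. -/
def Correct (P : TwoRoundProtocol) : Prop :=
  ∀ b : Bool, Negligible fun lam => 1 - P.honestOverlap lam b

/-- Security of OSP against QPT adversaries. As the sender sends only one message, the output bit of
an adversary is a function of that message. -/
def Secure (P : TwoRoundProtocol) : Prop :=
  ∀ Adv : ∀ lam, QCirc (Fin (P.lenS lam)) Unit, (PolyBounded fun lam => (Adv lam).size) →
    Negligible fun lam =>
      P.senExpect lam false (fun msgS _ => (Adv lam).prob msgS fun _ => false) -
      P.senExpect lam true (fun msgS _ => (Adv lam).prob msgS fun _ => false)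

/-- The protocol is a two-round oblivious state preparation protocol. -/
def IsOSP (P : TwoRoundProtocol) : Prop := P.Correct ∧ P.Secure

end TwoRoundProtocol

/-! ### Dual-mode trapdoor claw-free functions with efficient phase computation -/

/-- The algorithms of a dual-mode trapdoor claw-free function: PPT parameter generation `gen`
(input: the mode bit; output: `pp` and `sp`), a family of functions
`F_pp : {0,1} × {0,1}^n → {0,1}^m` that is computable in polynomial time from `pp`, distributions
`D_pp` on `{0,1}^n`, and PPT algorithms `PartialInvert(sp, y)`, which returns a subset of `{0,1}`
(given by its indicator), and `PhaseInvert(sp, y, d)`, which returns a bit. -/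
structure DualModeFamily : Type where
  lenPP : ℕ → ℕ
  lenSP : ℕ → ℕ
  n : ℕ → ℕ
  m : ℕ → ℕ
  gen : ∀ lam, RCirc Unit (Fin (lenPP lam) ⊕ Fin (lenSP lam))
  f : ∀ lam, BCirc (Fin (lenPP lam) ⊕ (Unit ⊕ Fin (n lam))) (Fin (m lam))
  dist : ∀ lam, Bits (Fin (lenPP lam)) → stdSimplex ℝ (Bits (Fin (n lam)))
  partialInvert : ∀ lam, RCirc (Fin (lenSP lam) ⊕ Fin (m lam)) Bool
  phaseInvert : ∀ lam, RCirc (Fin (lenSP lam) ⊕ (Fin (m lam) ⊕ Fin (n lam))) Unit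
  gen_ppt : PolyBounded fun lam => (gen lam).size
  f_ppt : PolyBounded fun lam => (f lam).size
  partialInvert_ppt : PolyBounded fun lam => (partialInvert lam).size
  phaseInvert_ppt : PolyBounded fun lam => (phaseInvert lam).size

namespace DualModeFamily

/-- `F_pp(b, x)`. -/
def F (T : DualModeFamily) (lam : ℕ) (pp : Bits (Fin (T.lenPP lam))) (b : Bool)
    (x : Bits (Fin (T.n lam))) : Bits (Fin (T.m lam)) :=
  (T.f lam).eval (Sum.elim pp (Sum.elim (fun _ => b) x))

/-- `D_pp(x)`. -/
def D (T : DualModeFamily) (lam : ℕ) (pp : Bits (Fin (T.lenPP lam)))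
    (x : Bits (Fin (T.n lam))) : ℝ := (T.dist lam pp).1 x

/-- The expectation of `g pp sp` over `(pp, sp) ← Gen(1^lam, μ)`. -/
noncomputable def genExpect (T : DualModeFamily) (lam : ℕ) (μ : Bool)
    (g : Bits (Fin (T.lenPP lam)) → Bits (Fin (T.lenSP lam)) → ℝ) : ℝ :=
  (T.gen lam).expect (fun _ => μ) fun o => g (o ∘ Sum.inl) (o ∘ Sum.inr)

/-- `pp` is a possible public parameter in mode `μ`. -/
def IsParam (T : DualModeFamily) (lam : ℕ) (μ : Bool) (pp : Bits (Fin (T.lenPP lam))) : Prop :=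
  ∃ r, (T.gen lam).eval (fun _ => μ) r ∘ Sum.inl = pp

/-- The density matrix of `|ψ_pp⟩ = ∑ x, √(D_pp(x)) |x⟩`. -/
noncomputable def idealState (T : DualModeFamily) (lam : ℕ) (pp : Bits (Fin (T.lenPP lam))) :
    Matrix (Bits (Fin (T.n lam))) (Bits (Fin (T.n lam))) ℂ :=
  Matrix.of fun x x' => (Real.sqrt (T.D lam pp x) : ℂ) * (Real.sqrt (T.D lam pp x') : ℂ)

/-- Efficient state preparation. -/
def EfficientPreparation (T : DualModeFamily) : Prop :=
  ∃ Prep : ∀ lam, QCirc (Fin (T.lenPP lam)) (Fin (T.n lam)),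
    (PolyBounded fun lam => (Prep lam).size) ∧
    ∃ ε : ℕ → ℝ, Negligible ε ∧ ∀ lam μ pp, T.IsParam lam μ pp →
      traceDist ((Prep lam).density pp) (T.idealState lam pp) ≤ ε lam

/-- Efficient partial inversion: for `y = F_pp(b, x)` with `x ← D_pp`, the algorithm returns the set of
the first bits of the preimages of `y`. -/
def EfficientPartialInversion (T : DualModeFamily) : Prop :=
  ∀ μ b : Bool, Negligible fun lam =>
    1 - T.genExpect lam μ fun pp sp => ∑ x, T.D lam pp x *
      (T.partialInvert lam).expect (Sum.elim sp (T.F lam pp b x)) fun B =>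
        ind (∀ b' : Bool, B b' = true ↔ ∃ x', T.F lam pp b' x' = T.F lam pp b x)

/-- Disjoint mode. -/
def DisjointMode (T : DualModeFamily) : Prop :=
  ∀ b : Bool, Negligible fun lam =>
    T.genExpect lam false fun pp _ => ∑ x, T.D lam pp x *
      ind (∃ x', T.F lam pp (!b) x' = T.F lam pp b x)

/-- The sign `(-1)^(d ⬝ x)`. -/
def phaseSign {N : ℕ} (d x : Bits (Fin N)) : ℝ := ∏ i, if d i && x i then -1 else 1

open Classical in
/-- `w_{pp,y,d,b}`, the sum of `(-1)^(d ⬝ x) √(D_pp(x))` over all `x` with `F_pp(b, x) = y`. -/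
noncomputable def w (T : DualModeFamily) (lam : ℕ) (pp : Bits (Fin (T.lenPP lam)))
    (y : Bits (Fin (T.m lam))) (d : Bits (Fin (T.n lam))) (b : Bool) : ℝ :=
  ∑ x ∈ Finset.univ.filter (fun x => T.F lam pp b x = y),
    phaseSign d x * Real.sqrt (T.D lam pp x)

/-- `w_{pp,y,d,0}² + w_{pp,y,d,1}²`. -/
noncomputable def normSq (T : DualModeFamily) (lam : ℕ) (pp : Bits (Fin (T.lenPP lam)))
    (y : Bits (Fin (T.m lam))) (d : Bits (Fin (T.n lam))) : ℝ :=
  T.w lam pp y d false ^ 2 + T.w lam pp y d true ^ 2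

/-- The normalized coefficient `w̃_{pp,y,d,b}`. -/
noncomputable def wTilde (T : DualModeFamily) (lam : ℕ) (pp : Bits (Fin (T.lenPP lam)))
    (y : Bits (Fin (T.m lam))) (d : Bits (Fin (T.n lam))) (b : Bool) : ℝ :=
  T.w lam pp y d b / Real.sqrt (T.normSq lam pp y d)

/-- The probability of the string `d`, given `y`: the distribution on `{0,1}^n` proportional to
`w_{pp,y,d,0}² + w_{pp,y,d,1}²`. This is the distribution of the outcome of measuring the register
of `x` in the Hadamard basis after the image `y` has been measured. The denominator is positive
for every `y = F_pp(b, x)` with `D_pp(x) > 0`. -/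
noncomputable def phaseProb (T : DualModeFamily) (lam : ℕ) (pp : Bits (Fin (T.lenPP lam)))
    (y : Bits (Fin (T.m lam))) (d : Bits (Fin (T.n lam))) : ℝ :=
  T.normSq lam pp y d / ∑ d', T.normSq lam pp y d'

/-- Lossy mode (efficient phase computation): for `b ← {0,1}`, `x ← D_pp`, `y = F_pp(b, x)`, and `d`
drawn from `phaseProb`, the algorithm returns `s` with `|w̃₀ - (-1)^s w̃₁| ≤ ν`. -/
def LossyMode (T : DualModeFamily) : Prop :=
  ∃ ν : ℕ → ℝ, Negligible ν ∧ Negligible fun lam =>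
    1 - T.genExpect lam true fun pp sp =>
      (∑ b : Bool, ∑ x, T.D lam pp x * ∑ d, T.phaseProb lam pp (T.F lam pp b x) d *
        (T.phaseInvert lam).expect (Sum.elim sp (Sum.elim (T.F lam pp b x) d)) fun s =>
          ind (|T.wTilde lam pp (T.F lam pp b x) d false -
            (if s () then -1 else 1) * T.wTilde lam pp (T.F lam pp b x) d true| ≤ ν lam)) / 2

/-- Mode indistinguishability against QPT adversaries. -/
def ModeIndistinguishable (T : DualModeFamily) : Prop :=
  ∀ Adv : ∀ lam, QCirc (Fin (T.lenPP lam)) Unit, (PolyBounded fun lam => (Adv lam).size) →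
    Negligible fun lam =>
      T.genExpect lam false (fun pp _ => (Adv lam).prob pp fun _ => true) -
      T.genExpect lam true (fun pp _ => (Adv lam).prob pp fun _ => true)

/-- The family is a dual-mode trapdoor claw-free function with efficient phase computation. -/
structure IsPhaseDTCF (T : DualModeFamily) : Prop where
  preparation : T.EfficientPreparation
  partialInversion : T.EfficientPartialInversion
  disjoint : T.DisjointMode
  lossy : T.LossyMode
  indistinguishable : T.ModeIndistinguishable

end DualModeFamily

/-! ### Negligible functions and polynomial bounds -/

/-! The sender runs `gen` in the mode given by its input bit and sends `pp`. The receiver prepares a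
uniform control bit next to the superposition of strings, evaluates `F` reversibly, measures the
image `y` and then, in the Hadamard basis, the string, obtaining `d`. It returns `(y, d)`; its
remaining qubit is proportional to `w₀|0⟩ + w₁|1⟩`. In disjoint mode, typically only one of the two
amplitudes is nonzero, so the qubit is a computational basis state, which partial inversion
identifies. In lossy mode the normalized amplitudes agree up to a computable sign `(-1)^s` and an
error `ν`, so the qubit is close to `H|s⟩`. The adversary sees only `pp`, so security is mode
indistinguishability itself.

Correctness is measured through squared overlaps. An overlap lies in `[0, 1]`, hence dominates its
square, and the square, weighted by the probability of the receiver's message, is linear in the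
prepared state (`le_honestOverlap`). For the ideal state it equals `2^-(n+1) (∑ c, t_c w_c)²`, with
`t` the target vector (`overlapSq_idealState`). Parseval's identity over `d` turns the disjoint-mode
total into the probability of guessing a uniform bit from its image (`le_score_false`); in lossy
mode the identity `(w₀ + σ w₁)² + (w₀ - σ w₁)² = 2 (w₀² + w₁²)`, `σ = ±1`, shows that the loss is at
most `ν²/2` (`overlapSq_true_ge`, `le_score_true`). Replacing the ideal state by the prepared one
costs at most the trace norm of the difference, because the measurement followed by projection on
the targets is a contraction (`norm_trace_conj_le_traceNorm`, `sum_overlapSq_measMatrix_sub_le`).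

The rest realizes the algorithms as circuits. A multiplexer joins the two decoders (`muxCirc_eval`).
Boolean circuits are evaluated quantumly by computing, copying and uncomputing
(`BCirc.permList_evalGates`), and tracing out the discarded qubits shows that the receiver acts by
the operators `measMatrix` (`rcvCirc_density`). -/

theorem Negligible.of_abs_le {f g : ℕ → ℝ} (hg : Negligible g) (h : ∀ n, |f n| ≤ |g n|) :
    Negligible f := fun c => by
  obtain ⟨N, hN⟩ := hg c
  exact ⟨N, fun n hn => (h n).trans_lt (hN n hn)⟩

theorem Negligible.abs {f : ℕ → ℝ} (hf : Negligible f) : Negligible fun n => |f n| :=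
  hf.of_abs_le fun n => (abs_abs (f n)).le

theorem Negligible.add {f g : ℕ → ℝ} (hf : Negligible f) (hg : Negligible g) :
    Negligible fun n => f n + g n := fun c => by
  -- Exponent `c + 1` leaves a spare factor `1/n`, which absorbs the 2 once `n ≥ 2`.
  obtain ⟨N, hN⟩ := hf (c + 1)
  obtain ⟨M, hM⟩ := hg (c + 1)
  refine ⟨max (max N M) 2, fun n hn => ?_⟩
  have h2 : (2 : ℝ) ≤ n := by
    have : 2 ≤ n := by omega
    exact_mod_cast this
  have hpos : (0 : ℝ) < (n : ℝ) ^ c := by positivity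
  calc |f n + g n| ≤ |f n| + |g n| := abs_add_le _ _
    _ < ((n : ℝ) ^ (c + 1))⁻¹ + ((n : ℝ) ^ (c + 1))⁻¹ :=
        add_lt_add (hN n (by omega)) (hM n (by omega))
    _ = (2 / n) * ((n : ℝ) ^ c)⁻¹ := by
        rw [pow_succ]; field_simp; norm_num
    _ ≤ 1 * ((n : ℝ) ^ c)⁻¹ := by
        gcongr
        rw [div_le_one (by linarith)]; exact h2
    _ = _ := one_mul _

/-- The bound `n ^ (-c)` is at most 1, so squaring a value below it keeps it below. -/
theorem Negligible.sq {f : ℕ → ℝ} (hf : Negligible f) : Negligible fun n => f n ^ 2 := fun c => by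
  obtain ⟨N, hN⟩ := hf c
  refine ⟨N, fun n hn => ?_⟩
  have h1 : (1 : ℝ) ≤ n := by
    have : 1 ≤ n := by omega
    exact_mod_cast this
  have h := hN n hn
  have hle : ((n : ℝ) ^ c)⁻¹ ≤ 1 := inv_le_one_of_one_le₀ (one_le_pow₀ h1)
  have h0 := abs_nonneg (f n)
  rw [abs_pow]
  nlinarith

theorem PolyBounded.mono {f g : ℕ → ℕ} (hg : PolyBounded g) (h : ∀ n, f n ≤ g n) :
    PolyBounded f := by
  obtain ⟨c, N, hN⟩ := hg
  exact ⟨c, N, fun n hn => (h n).trans_lt (hN n hn)⟩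

theorem PolyBounded.add {f g : ℕ → ℕ} (hf : PolyBounded f) (hg : PolyBounded g) :
    PolyBounded fun n => f n + g n := by
  obtain ⟨c, N, hN⟩ := hf
  obtain ⟨d, M, hM⟩ := hg
  refine ⟨max c d + 1, max (max N M) 2, fun n hn => ?_⟩
  have h1 := (hN n (by omega)).trans_le
    (Nat.pow_le_pow_right (by omega) (le_max_left c d) : n ^ c ≤ n ^ max c d)
  have h2 := (hM n (by omega)).trans_le
    (Nat.pow_le_pow_right (by omega) (le_max_right c d) : n ^ d ≤ n ^ max c d)
  calc f n + g n < 2 * n ^ max c d := by omega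
    _ ≤ n * n ^ max c d := Nat.mul_le_mul_right _ (by omega)
    _ = n ^ (max c d + 1) := by ring

theorem PolyBounded.const (k : ℕ) : PolyBounded fun _ => k :=
  ⟨1, k, fun n hn => by simpa using hn⟩

/-! ### Composing classical circuits -/

section Classical

variable {ι ι' ι₁ ι₂ κ κ₁ κ₂ : Type}

/-- One step of the evaluation of a Boolean circuit. -/
def evalStep (x : Bits ι) (vals : List Bool) (g : BGate ι) : List Bool := vals ++ [g.eval x vals]

theorem BCirc.run_eq (C : BCirc ι κ) (x : Bits ι) : C.run x = C.gates.foldl (evalStep x) [] := rfl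

theorem length_foldl_evalStep (x : Bits ι) (gs : List (BGate ι)) (vals : List Bool) :
    (gs.foldl (evalStep x) vals).length = vals.length + gs.length := by
  induction gs generalizing vals with
  | nil => simp
  | cons g gs ih => simp only [List.foldl_cons, ih, evalStep]; simp; omega

theorem BCirc.length_run (C : BCirc ι κ) (x : Bits ι) : (C.run x).length = C.gates.length := by
  rw [BCirc.run_eq, length_foldl_evalStep]; simp

/-- Relabel the inputs of a gate by `f` and shift its references to earlier gates by `off`. -/
def BGate.rewire (f : ι → ι') (off : ℕ) : BGate ι → BGate ι'
  | .const b => .const b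
  | .not i => .not (i.map f (off + ·))
  | .and i j => .and (i.map f (off + ·)) (j.map f (off + ·))
  | .xor i j => .xor (i.map f (off + ·)) (j.map f (off + ·))

/-- No well-formedness of the circuit is needed: a reference past the end of `vals` is still past
the end after the shift, and both read `false`. -/
theorem wireValue_map (f : ι → ι') (x : Bits ι') (pre vals : List Bool) (i : ι ⊕ ℕ) :
    wireValue x (pre ++ vals) (i.map f (pre.length + ·)) = wireValue (x ∘ f) vals i := by
  rcases i with i | k
  · rfl
  · simp [wireValue, List.getElem?_append_right]

theorem BGate.eval_rewire (f : ι → ι') (x : Bits ι') (pre vals : List Bool) (g : BGate ι) :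
    (g.rewire f pre.length).eval x (pre ++ vals) = g.eval (x ∘ f) vals := by
  cases g <;> simp only [BGate.rewire, BGate.eval, wireValue_map]

theorem foldl_rewire (f : ι → ι') (x : Bits ι') (pre vals : List Bool) (gs : List (BGate ι)) :
    (gs.map (BGate.rewire f pre.length)).foldl (evalStep x) (pre ++ vals) =
      pre ++ gs.foldl (evalStep (x ∘ f)) vals := by
  induction gs generalizing vals with
  | nil => rfl
  | cons g gs ih =>
    simp only [List.map_cons, List.foldl_cons, ← ih, evalStep, BGate.eval_rewire,
      List.append_assoc]

theorem BCirc.foldl_gates_rewire (C : BCirc ι κ) (f : ι → ι') (x : Bits ι') (pre : List Bool) :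
    (C.gates.map (BGate.rewire f pre.length)).foldl (evalStep x) pre = pre ++ C.run (x ∘ f) := by
  simpa [BCirc.run_eq] using foldl_rewire f x pre [] C.gates

/-- The wire that carries the output `k` of `C` after `C` was appended to `off` other gates;
`dead` is a wire without a value. -/
def BCirc.outWire (C : BCirc ι κ) (f : ι → ι') (off dead : ℕ) (k : κ) : ι' ⊕ ℕ :=
  match C.out k with
  | Sum.inl i => Sum.inl (f i)
  | Sum.inr j => if j < C.gates.length then Sum.inr (off + j) else Sum.inr dead

/-- An output of `C` that refers to a nonexistent gate reads `false`, but a plain shift would make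
it read a value from `post`. Redirecting it to `dead`, which `h` places beyond all values, keeps it
`false`. -/
theorem BCirc.wireValue_outWire (C : BCirc ι κ) (f : ι → ι') (x : Bits ι') (pre post : List Bool)
    (dead : ℕ) (h : (pre ++ C.run (x ∘ f) ++ post).length ≤ dead) (k : κ) :
    wireValue x (pre ++ C.run (x ∘ f) ++ post) (C.outWire f pre.length dead k) =
      C.eval (x ∘ f) k := by
  unfold BCirc.outWire BCirc.eval
  rcases C.out k with i | j
  · rfl
  · have hl := C.length_run (x ∘ f)
    by_cases hj : j < C.gates.length
    · simp [hj, wireValue, List.getElem?_append_right, List.getElem?_append_left, hl]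
    · simp only [hj, if_false, wireValue]
      rw [List.getD_eq_default _ _ h, List.getD_eq_default _ _ (by omega)]

/-- The circuit returning the output `k₂` of `C₂` if the input `sel` is set, and the output `k₁` of
`C₁` otherwise. -/
def muxCirc (sel : ι) (C₁ : BCirc ι₁ κ₁) (f₁ : ι₁ → ι) (k₁ : κ₁) (C₂ : BCirc ι₂ κ₂) (f₂ : ι₂ → ι)
    (k₂ : κ₂) : BCirc ι Unit where
  gates := C₁.gates.map (BGate.rewire f₁ 0) ++
    (C₂.gates.map (BGate.rewire f₂ C₁.gates.length) ++
    [.not (Sum.inl sel),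
      .and (Sum.inr (C₁.gates.length + C₂.gates.length))
        (C₁.outWire f₁ 0 (C₁.gates.length + C₂.gates.length + 4) k₁),
      .and (Sum.inl sel)
        (C₂.outWire f₂ C₁.gates.length (C₁.gates.length + C₂.gates.length + 4) k₂),
      .xor (Sum.inr (C₁.gates.length + C₂.gates.length + 1))
        (Sum.inr (C₁.gates.length + C₂.gates.length + 2))])
  out := fun _ => Sum.inr (C₁.gates.length + C₂.gates.length + 3)

/-- The multiplexer is `(¬sel ∧ A) xor (sel ∧ B)`. The wires `a` and `b` are read while new values
are being appended, so their values must be stable under extension of `L`. -/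
theorem mux_gates_eval (x : Bits ι) (sel : ι) (L : List Bool) (a b : ι ⊕ ℕ) (A B : Bool)
    (ha : ∀ post : List Bool, post.length ≤ 4 → wireValue x (L ++ post) a = A)
    (hb : ∀ post : List Bool, post.length ≤ 4 → wireValue x (L ++ post) b = B) :
    wireValue x ([BGate.not (Sum.inl sel), .and (Sum.inr L.length) a, .and (Sum.inl sel) b,
      .xor (Sum.inr (L.length + 1)) (Sum.inr (L.length + 2))].foldl (evalStep x) L)
      (Sum.inr (L.length + 3)) = if x sel then B else A := by
  have h : [BGate.not (Sum.inl sel), .and (Sum.inr L.length) a, .and (Sum.inl sel) b,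
      .xor (Sum.inr (L.length + 1)) (Sum.inr (L.length + 2))].foldl (evalStep x) L =
      L ++ [!x sel, !x sel && A, x sel && B, Bool.xor (!x sel && A) (x sel && B)] := by
    simp only [List.foldl_cons, List.foldl_nil, evalStep, BGate.eval, List.append_assoc,
      ha _ (by simp : [_].length ≤ 4), hb _ (by simp : ([_] ++ [_]).length ≤ 4)]
    simp [wireValue]
  rw [h]
  cases x sel <;> simp [wireValue]

theorem muxCirc_eval (sel : ι) (C₁ : BCirc ι₁ κ₁) (f₁ : ι₁ → ι) (k₁ : κ₁) (C₂ : BCirc ι₂ κ₂)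
    (f₂ : ι₂ → ι) (k₂ : κ₂) (x : Bits ι) :
    (muxCirc sel C₁ f₁ k₁ C₂ f₂ k₂).eval x =
      fun _ => if x sel then C₂.eval (x ∘ f₂) k₂ else C₁.eval (x ∘ f₁) k₁ := by
  funext u
  have l₁ := C₁.length_run (x ∘ f₁)
  have l₂ := C₂.length_run (x ∘ f₂)
  have e₁ := C₁.foldl_gates_rewire f₁ x []
  have e₂ := C₂.foldl_gates_rewire f₂ x (C₁.run (x ∘ f₁))
  simp only [List.length_nil, List.nil_append, l₁] at e₁ e₂
  have hl : (C₁.run (x ∘ f₁) ++ C₂.run (x ∘ f₂)).length = C₁.gates.length + C₂.gates.length := by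
    simp [l₁, l₂]
  have key := mux_gates_eval x sel (C₁.run (x ∘ f₁) ++ C₂.run (x ∘ f₂))
    (C₁.outWire f₁ 0 (C₁.gates.length + C₂.gates.length + 4) k₁)
    (C₂.outWire f₂ C₁.gates.length (C₁.gates.length + C₂.gates.length + 4) k₂)
    (C₁.eval (x ∘ f₁) k₁) (C₂.eval (x ∘ f₂) k₂)
    (fun post h => by
      have := C₁.wireValue_outWire f₁ x [] (C₂.run (x ∘ f₂) ++ post)
        (C₁.gates.length + C₂.gates.length + 4) (by simp [l₁, l₂]; omega) k₁
      simpa using this)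
    (fun post h => by
      have := C₂.wireValue_outWire f₂ x (C₁.run (x ∘ f₁)) post
        (C₁.gates.length + C₂.gates.length + 4) (by simp [l₁, l₂]; omega) k₂
      simpa [l₁] using this)
  rw [hl] at key
  rw [← key]
  unfold BCirc.eval
  rw [BCirc.run_eq]
  simp only [muxCirc, List.foldl_append, e₁, e₂]

end Classical

/-! ### General facts on quantum circuits -/

section Quantum

variable {V W ι κ : Type} [DecidableEq V] [DecidableEq W]

/-- The action of a list of gates. -/
noncomputable def actList (gs : List (QGate W)) (ψ : Bits W → ℂ) : Bits W → ℂ :=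
  gs.foldl (fun ψ g => g.act ψ) ψ

@[simp] theorem actList_nil (ψ : Bits W → ℂ) : actList [] ψ = ψ := rfl

@[simp] theorem actList_cons (g : QGate W) (gs : List (QGate W)) (ψ : Bits W → ℂ) :
    actList (g :: gs) ψ = actList gs (g.act ψ) := rfl

theorem actList_append (gs hs : List (QGate W)) (ψ : Bits W → ℂ) :
    actList (gs ++ hs) ψ = actList hs (actList gs ψ) := by
  simp [actList]

/-- The basis state `|z⟩`. -/
def basisState (z : Bits W) [DecidableEq (Bits W)] : Bits W → ℂ := fun z' => if z' = z then 1 else 0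

theorem QCirc.final_eq [Fintype ι] [DecidableEq ι] (C : QCirc ι κ) (x : Bits ι) :
    C.final x = actList C.gates (basisState (Sum.elim x fun _ => false)) := rfl

theorem QGate.act_zero (g : QGate W) : g.act (fun _ => 0) = fun _ => 0 := by
  cases g <;> funext z <;> simp [QGate.act]

theorem actList_zero (gs : List (QGate W)) : actList gs (fun _ => 0) = fun _ => 0 := by
  induction gs with
  | nil => rfl
  | cons g gs ih => rw [actList_cons, QGate.act_zero, ih]

/-- Relabel the wires of a gate. -/
def QGate.map (j : V → W) (hj : Function.Injective j) : QGate V → QGate W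
  | .hadamard i => .hadamard (j i)
  | .tgate i => .tgate (j i)
  | .not i => .not (j i)
  | .cnot c t h => .cnot (j c) (j t) (hj.ne h)
  | .toffoli a b t ha hb => .toffoli (j a) (j b) (j t) (hj.ne ha) (hj.ne hb)

/-- If `c` embeds the configurations of `V` into those of `W` compatibly with the relabelling `j`
of wires, then a relabelled gate acts along `c` as the original one. -/
theorem QGate.act_map (j : V → W) (hj : Function.Injective j) (c : Bits V → Bits W)
    (h₁ : ∀ v i, c v (j i) = v i)
    (h₂ : ∀ v i b, c (Function.update v i b) = Function.update (c v) (j i) b)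
    (g : QGate V) (ψ : Bits W → ℂ) : ((g.map j hj).act ψ) ∘ c = g.act (ψ ∘ c) := by
  cases g <;> funext v <;> simp [QGate.map, QGate.act, h₁, h₂]

theorem actList_map (j : V → W) (hj : Function.Injective j) (c : Bits V → Bits W)
    (h₁ : ∀ v i, c v (j i) = v i)
    (h₂ : ∀ v i b, c (Function.update v i b) = Function.update (c v) (j i) b)
    (gs : List (QGate V)) (ψ : Bits W → ℂ) :
    (actList (gs.map (QGate.map j hj)) ψ) ∘ c = actList gs (ψ ∘ c) := by
  induction gs generalizing ψ with
  | nil => rfl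
  | cons g gs ih =>
    rw [List.map_cons, actList_cons, actList_cons, ih, QGate.act_map j hj c h₁ h₂]

/-! #### Norm preservation -/

/-- Flip the bit `i`. -/
def flipBit (i : W) (z : Bits W) : Bits W := Function.update z i (!(z i))

theorem flipBit_involutive (i : W) : Function.Involutive (flipBit i) := fun z => by
  simp [flipBit]

/-- The permutation of the basis states given by a classical gate (the identity for the other
gates). -/
def QGate.perm : QGate W → Bits W → Bits W
  | .not i, z => Function.update z i (!(z i))
  | .cnot c t _, z => Function.update z t (Bool.xor (z t) (z c))
  | .toffoli a b t _ _, z => Function.update z t (Bool.xor (z t) (z a && z b))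
  | .hadamard _, z => z
  | .tgate _, z => z

/-- The gate permutes the basis states. -/
def QGate.IsClassical : QGate W → Prop
  | .hadamard _ => False
  | .tgate _ => False
  | _ => True

/-- Controls differ from the target, so they survive the first application and the second xor
cancels the first. -/
theorem QGate.perm_involutive (g : QGate W) : Function.Involutive g.perm := by
  intro z
  cases g with
  | hadamard i => rfl
  | tgate i => rfl
  | not i => simp [QGate.perm]
  | cnot c t h => simp [QGate.perm, Function.update_of_ne h]
  | toffoli a b t ha hb => simp [QGate.perm, Function.update_of_ne ha, Function.update_of_ne hb]

theorem QGate.act_of_isClassical {g : QGate W} (hg : g.IsClassical) (ψ : Bits W → ℂ) :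
    g.act ψ = ψ ∘ g.perm := by
  cases g <;> first | rfl | exact hg.elim

/-- Classical gates permute the amplitudes and `T` multiplies them by phases. A Hadamard gate mixes
only the pair `z`, `flipBit i z`, on which the parallelogram law applies. -/
theorem QGate.sum_norm_sq_act [Fintype W] (g : QGate W) (ψ : Bits W → ℂ) :
    ∑ z, ‖g.act ψ z‖ ^ 2 = ∑ z, ‖ψ z‖ ^ 2 := by
  by_cases hg : g.IsClassical
  · rw [QGate.act_of_isClassical hg]
    exact Equiv.sum_comp g.perm_involutive.toPerm fun z => ‖ψ z‖ ^ 2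
  cases g with
  | hadamard i =>
    have hflip : ∀ f : Bits W → ℝ, ∑ z, f (flipBit i z) = ∑ z, f z := fun f =>
      Equiv.sum_comp (flipBit_involutive i).toPerm f
    have key : ∀ z, ‖(QGate.hadamard i).act ψ z‖ ^ 2 + ‖(QGate.hadamard i).act ψ (flipBit i z)‖ ^ 2
        = ‖ψ z‖ ^ 2 + ‖ψ (flipBit i z)‖ ^ 2 := by
      have h2 : ‖((Real.sqrt 2 : ℝ) : ℂ)‖ ^ 2 = 2 := by
        rw [Complex.norm_real, Real.norm_of_nonneg (Real.sqrt_nonneg _), Real.sq_sqrt (by norm_num)]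
      have par : ∀ a b : ℂ, ‖a + b‖ ^ 2 + ‖a - b‖ ^ 2 = 2 * (‖a‖ ^ 2 + ‖b‖ ^ 2) := fun a b => by
        simpa [sq] using parallelogram_law_with_norm ℂ a b
      intro z
      have par' := par (ψ (Function.update z i false)) (ψ (Function.update z i true))
      rw [sub_eq_add_neg] at par'
      rcases hz : z i with _ | _
      · have e : Function.update z i false = z := by rw [← hz, Function.update_eq_self]
        rw [e] at par'
        simp only [QGate.act, flipBit, hz, norm_div, div_pow, h2]
        simp [e]
        linarith
      · have e : Function.update z i true = z := by rw [← hz, Function.update_eq_self]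
        rw [e] at par'
        simp only [QGate.act, flipBit, hz, norm_div, div_pow, h2]
        simp [e]
        linarith
    -- Summing over all `z` counts every pair twice on both sides.
    have h := Finset.sum_congr (rfl : (Finset.univ : Finset (Bits W)) = _) fun z _ => key z
    rw [Finset.sum_add_distrib, Finset.sum_add_distrib,
      hflip fun z => ‖(QGate.hadamard i).act ψ z‖ ^ 2, hflip fun z => ‖ψ z‖ ^ 2] at h
    linarith
  | tgate i =>
    refine Finset.sum_congr rfl fun z _ => ?_
    have h1 : ‖Complex.exp (Complex.I * (Real.pi / 4 : ℂ))‖ = 1 := by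
      have := Complex.norm_exp_I_mul_ofReal (Real.pi / 4)
      push_cast at this
      exact this
    cases hz : z i <;> simp [QGate.act, hz, h1]
  | not i => exact (hg trivial).elim
  | cnot c t h => exact (hg trivial).elim
  | toffoli a b t ha hb => exact (hg trivial).elim

theorem sum_norm_sq_actList [Fintype W] (gs : List (QGate W)) (ψ : Bits W → ℂ) :
    ∑ z, ‖actList gs ψ z‖ ^ 2 = ∑ z, ‖ψ z‖ ^ 2 := by
  induction gs generalizing ψ with
  | nil => rfl
  | cons g gs ih => rw [actList_cons, ih, QGate.sum_norm_sq_act]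

theorem QCirc.sum_norm_sq_final [Fintype ι] [DecidableEq ι] (C : QCirc ι κ) (x : Bits ι) :
    ∑ z, ‖C.final x z‖ ^ 2 = 1 := by
  rw [QCirc.final_eq, sum_norm_sq_actList]
  simp only [basisState]
  rw [Finset.sum_eq_single (Sum.elim x fun _ => false)]
  · simp
  · intro b _ hb; simp [hb]
  · simp

/-- The unnormalized state of the output wires when the discarded wires are in the state `g`. -/
noncomputable def QCirc.slice [Fintype ι] [DecidableEq ι] (C : QCirc ι κ) (x : Bits ι)
    (g : Bits (Fin C.gar)) (z : Bits κ) : ℂ := C.final x (Sum.elim z g ∘ C.wires)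

theorem QCirc.density_apply [Fintype ι] [DecidableEq ι] (C : QCirc ι κ) (x : Bits ι)
    (z z' : Bits κ) : C.density x z z' = ∑ g, C.slice x g z * star (C.slice x g z') := rfl

theorem QCirc.prob_eq [Fintype ι] [DecidableEq ι] (C : QCirc ι κ) (x : Bits ι) (z : Bits κ) :
    C.prob x z = ∑ g, ‖C.slice x g z‖ ^ 2 := by
  simp only [QCirc.prob, QCirc.density_apply, Complex.re_sum]
  refine Finset.sum_congr rfl fun g _ => ?_
  rw [Complex.star_def, Complex.mul_conj, Complex.ofReal_re, Complex.normSq_eq_norm_sq]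

/-- An output string together with a string on the discarded wires is exactly a configuration of all
wires, so this is the norm of the final state. -/
theorem QCirc.sum_prob [Fintype ι] [DecidableEq ι] [Fintype κ] [DecidableEq κ]
    (C : QCirc ι κ) (x : Bits ι) : ∑ z, C.prob x z = 1 := by
  simp only [QCirc.prob_eq]
  rw [← C.sum_norm_sq_final x, ← Fintype.sum_prod_type']
  refine Fintype.sum_equiv ((Equiv.sumArrowEquivProdArrow κ (Fin C.gar) Bool).symm.trans
    (C.wires.symm.arrowCongr (Equiv.refl Bool))) _ _ fun p => ?_
  rfl

/-! #### Layers of Hadamard gates -/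

/-- The matrix of a partial layer is a tensor product: a sign at the positions already treated, an
identity at the others. Keeping both kinds of factors makes the induction possible. -/
theorem actList_hadamard_list [Fintype V] (l : List V) (hl : l.Nodup) (φ : Bits V → ℂ)
    (d : Bits V) :
    actList (l.map QGate.hadamard) φ d = ((Real.sqrt 2 : ℂ) ^ l.length)⁻¹ *
      ∑ x : Bits V, (∏ i, if i ∈ l then (if d i && x i then -1 else 1)
        else if d i = x i then (1 : ℂ) else 0) * φ x := by
  -- The last gate acts outermost, so peeling it off writes the new amplitude directly in terms of
  -- two old ones.
  induction l using List.reverseRecOn generalizing d with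
  | nil =>
    simp only [List.map_nil, actList_nil, List.length_nil, pow_zero, inv_one, one_mul,
      List.not_mem_nil, if_false]
    rw [Finset.sum_eq_single d]
    · simp
    · intro x _ hx
      obtain ⟨i, hi⟩ := Function.ne_iff.mp hx
      rw [Finset.prod_eq_zero (Finset.mem_univ i) (by rw [if_neg (Ne.symm hi)]), zero_mul]
    · simp
  | append_singleton l a ih =>
    rw [List.nodup_append] at hl
    obtain ⟨hl, -, hdisj⟩ := hl
    have ha : a ∉ l := fun h => hdisj a h a (by simp) rfl
    rw [List.map_append, actList_append]
    simp only [List.map_cons, List.map_nil, actList_cons, actList_nil, QGate.act, ih hl]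
    rw [List.length_append, List.length_singleton, pow_succ, mul_inv, mul_assoc, mul_left_comm,
      ← mul_add, mul_div_assoc]
    congr 1
    rw [Finset.mul_sum, ← Finset.sum_add_distrib, Finset.sum_div, Finset.mul_sum]
    refine Finset.sum_congr rfl fun x _ => ?_
    -- The two amplitudes combined by the gate at `a` differ only in the factor at `a`, an identity
    -- entry because `a ∉ l`.
    have hsplit : ∀ b : Bool, (∏ i, if i ∈ l then (if Function.update d a b i && x i then -1 else 1)
        else if Function.update d a b i = x i then (1 : ℂ) else 0) =
        (if b = x a then 1 else 0) * ∏ i ∈ Finset.univ.erase a,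
          (if i ∈ l then (if d i && x i then -1 else 1) else if d i = x i then (1 : ℂ) else 0) := by
      intro b
      rw [← Finset.mul_prod_erase Finset.univ _ (Finset.mem_univ a)]
      simp only [ha, if_false, Function.update_self]
      congr 1
      refine Finset.prod_congr rfl fun i hi => ?_
      rw [Function.update_of_ne (Finset.ne_of_mem_erase hi)]
    have hsplit' : (∏ i, if i ∈ l ++ [a] then (if d i && x i then -1 else 1)
        else if d i = x i then (1 : ℂ) else 0) =
        (if d a && x a then -1 else 1) * ∏ i ∈ Finset.univ.erase a,
          (if i ∈ l then (if d i && x i then -1 else 1) else if d i = x i then (1 : ℂ) else 0) := by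
      rw [← Finset.mul_prod_erase Finset.univ _ (Finset.mem_univ a)]
      congr 1
      · simp
      refine Finset.prod_congr rfl fun i hi => ?_
      simp [Finset.ne_of_mem_erase hi]
    rw [hsplit, hsplit, hsplit']
    generalize (∏ i ∈ Finset.univ.erase a, _ : ℂ) = p
    cases d a <;> cases x a <;> simp <;> ring

/-- Hadamard gates on all of the qubits `Fin N`. -/
def hadamardLayer (N : ℕ) : List (QGate (Fin N)) := (List.finRange N).map QGate.hadamard

theorem actList_hadamardLayer {N : ℕ} (φ : Bits (Fin N) → ℂ) (d : Bits (Fin N)) :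
    actList (hadamardLayer N) φ d = ((Real.sqrt 2 : ℂ) ^ N)⁻¹ *
      ∑ x, (DualModeFamily.phaseSign d x : ℂ) * φ x := by
  rw [hadamardLayer, actList_hadamard_list _ (List.nodup_finRange N), List.length_finRange]
  congr 1
  refine Finset.sum_congr rfl fun x _ => ?_
  simp only [DualModeFamily.phaseSign, List.mem_finRange, if_true]
  push_cast
  congr 1
  exact Finset.prod_congr rfl fun i _ => by split_ifs <;> simp

/-- Parseval's identity, read off from norm preservation by the Hadamard layer after clearing its
factor `2 ^ (-N/2)`. -/
theorem sum_norm_sq_phaseSign {N : ℕ} (φ : Bits (Fin N) → ℂ) :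
    ∑ d, ‖∑ x, (DualModeFamily.phaseSign d x : ℂ) * φ x‖ ^ 2 = 2 ^ N * ∑ x, ‖φ x‖ ^ 2 := by
  rw [← sum_norm_sq_actList (hadamardLayer N) φ, Finset.mul_sum]
  refine Finset.sum_congr rfl fun d _ => ?_
  rw [actList_hadamardLayer, norm_mul, mul_pow, norm_inv, norm_pow, Complex.norm_real,
    Real.norm_of_nonneg (Real.sqrt_nonneg _), inv_pow, ← pow_mul, mul_comm N 2, pow_mul,
    Real.sq_sqrt (by norm_num)]
  field_simp

/-! #### Classical gates -/

/-- The action of a list of classical gates on basis states. -/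
def permList (gs : List (QGate W)) (z : Bits W) : Bits W := gs.foldl (fun z g => g.perm z) z

@[simp] theorem permList_nil (z : Bits W) : permList [] z = z := rfl

@[simp] theorem permList_cons (g : QGate W) (gs : List (QGate W)) (z : Bits W) :
    permList (g :: gs) z = permList gs (g.perm z) := rfl

theorem permList_append (gs hs : List (QGate W)) (z : Bits W) :
    permList (gs ++ hs) z = permList hs (permList gs z) := by
  simp [permList]

/-- Each gate's permutation is its own inverse, so reversing the order inverts the circuit. -/
theorem permList_reverse_permList (gs : List (QGate W)) (z : Bits W) :
    permList gs.reverse (permList gs z) = z := by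
  induction gs generalizing z with
  | nil => rfl
  | cons g gs ih =>
    rw [List.reverse_cons, permList_append, permList_cons g gs, ih]
    exact g.perm_involutive z

theorem permList_permList_reverse (gs : List (QGate W)) (z : Bits W) :
    permList gs (permList gs.reverse z) = z := by
  simpa using permList_reverse_permList gs.reverse z

theorem actList_permList (gs : List (QGate W)) (h : ∀ g ∈ gs, g.IsClassical) (ψ : Bits W → ℂ)
    (z : Bits W) : actList gs ψ (permList gs z) = ψ z := by
  induction gs generalizing ψ z with
  | nil => rfl
  | cons g gs ih =>
    rw [permList_cons, actList_cons, ih (fun g' hg' => h g' (List.mem_cons_of_mem _ hg')),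
      QGate.act_of_isClassical (h g List.mem_cons_self), Function.comp_apply, g.perm_involutive]

theorem actList_basisState [DecidableEq (Bits W)] (gs : List (QGate W))
    (h : ∀ g ∈ gs, g.IsClassical) (z : Bits W) :
    actList gs (basisState z) = basisState (permList gs z) := by
  funext z'
  obtain ⟨u, rfl⟩ : ∃ u, permList gs u = z' := ⟨_, permList_permList_reverse gs z'⟩
  rw [actList_permList gs h]
  unfold basisState
  have : permList gs u = permList gs z ↔ u = z :=
    (Function.LeftInverse.injective (permList_reverse_permList gs)).eq_iff
  simp only [this]

/-! #### Circuits over arbitrary ancilla labels -/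

/-- The quantum circuit with ancillas labelled by `A` and discarded wires labelled by `Γ`. -/
noncomputable def QCirc.ofLabels {A Γ : Type} [Fintype A] [Fintype Γ]
    (gs : List (QGate (ι ⊕ A))) (e : ι ⊕ A ≃ κ ⊕ Γ) : QCirc ι κ where
  anc := Fintype.card A
  gar := Fintype.card Γ
  gates := gs.map (QGate.map (Equiv.sumCongr (Equiv.refl ι) (Fintype.equivFin A))
    (Equiv.injective _))
  wires := ((Equiv.sumCongr (Equiv.refl ι) (Fintype.equivFin A)).symm.trans e).trans
    (Equiv.sumCongr (Equiv.refl κ) (Fintype.equivFin Γ))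

/-- Numbering the ancillas and the discarded wires is only a relabelling, and the partial trace sums
over all their values. Descriptive labels can then be used for the receiver. -/
theorem QCirc.density_ofLabels {A Γ : Type} [Fintype A] [Fintype Γ] [DecidableEq A] [Fintype ι]
    [DecidableEq ι] [DecidableEq Γ] (gs : List (QGate (ι ⊕ A))) (e : ι ⊕ A ≃ κ ⊕ Γ)
    (x : Bits ι) (z z' : Bits κ) :
    (QCirc.ofLabels gs e).density x z z' = ∑ g : Bits Γ,
      actList gs (basisState (Sum.elim x fun _ => false)) (Sum.elim z g ∘ e) *
      star (actList gs (basisState (Sum.elim x fun _ => false)) (Sum.elim z' g ∘ e)) := by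
  rw [QCirc.density_apply]
  set E := Equiv.sumCongr (Equiv.refl ι) (Fintype.equivFin A) with hE
  have key : ∀ (g : Bits Γ) (z : Bits κ),
      (QCirc.ofLabels gs e).slice x (g ∘ (Fintype.equivFin Γ).symm) z =
      actList gs (basisState (Sum.elim x fun _ => false)) (Sum.elim z g ∘ e) := by
    intro g z
    have h := congrFun (actList_map E E.injective (fun v => v ∘ E.symm)
      (fun v i => by simp) (fun v i b => by
        rw [Function.update_comp_equiv]; simp) gs
        (basisState (Sum.elim x fun _ => false))) (Sum.elim z g ∘ e)
    rw [Function.comp_apply] at h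
    refine Eq.trans ?_ (h.trans ?_)
    · rw [QCirc.slice, QCirc.final_eq]
      congr 1
      funext w
      change Sum.elim z (g ∘ (Fintype.equivFin Γ).symm)
        (Equiv.sumCongr (Equiv.refl κ) (Fintype.equivFin Γ) (e (E.symm w))) =
          Sum.elim z g (e (E.symm w))
      rcases e (E.symm w) with k | k <;> simp
    · congr 1
      funext v
      have : v ∘ E.symm = (Sum.elim x fun _ => false) ↔ v = Sum.elim x fun _ => false := by
        rw [← E.symm.surjective.injective_comp_right.eq_iff (a := v)]
        have : (Sum.elim x fun _ => false : Bits (ι ⊕ A)) ∘ E.symm = Sum.elim x fun _ => false := by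
          funext w
          rcases w with w | w <;> rfl
        rw [this]
      simp only [Function.comp_apply, basisState, this]
  symm
  refine Fintype.sum_equiv ((Fintype.equivFin Γ).arrowCongr (Equiv.refl Bool)) _ _ fun g => ?_
  simp only [← key]
  rfl

end Quantum

/-! ### Reversible evaluation of Boolean circuits -/

section Reversible

variable {ι κ W : Type} [DecidableEq W]

theorem permList_cnots_of_ne (s t : κ → W) (hst : ∀ k k', s k ≠ t k') (l : List κ) (z : Bits W)
    (w : W) (hw : ∀ k ∈ l, w ≠ t k) :
    permList (l.map fun k => QGate.cnot (s k) (t k) (hst k k)) z w = z w := by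
  induction l generalizing z with
  | nil => rfl
  | cons k l ih =>
    rw [List.map_cons, permList_cons, ih _ fun k' hk' => hw k' (List.mem_cons_of_mem _ hk')]
    exact Function.update_of_ne (hw k List.mem_cons_self) _ _

/-- No target is a source and the targets are distinct, so the gates do not interfere and each
target is changed once. -/
theorem permList_cnots_target (s t : κ → W) (hst : ∀ k k', s k ≠ t k')
    (ht : Function.Injective t) (l : List κ) (hl : l.Nodup) (z : Bits W) (k : κ) (hk : k ∈ l) :
    permList (l.map fun k => QGate.cnot (s k) (t k) (hst k k)) z (t k) =
      Bool.xor (z (t k)) (z (s k)) := by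
  induction l generalizing z with
  | nil => simp at hk
  | cons k' l ih =>
    rw [List.nodup_cons] at hl
    rw [List.map_cons, permList_cons]
    by_cases hkk : k = k'
    · subst hkk
      rw [permList_cnots_of_ne s t hst l _ _ fun i hi => ht.ne (by rintro rfl; exact hl.1 hi)]
      exact Function.update_self _ _ _
    · rw [ih hl.2 _ (by simpa [hkk] using hk)]
      simp only [QGate.perm]
      rw [Function.update_of_ne (ht.ne hkk), Function.update_of_ne (hst k k')]

/-- The qubit carrying a wire of a Boolean circuit when `p` of its `G` gates have been evaluated;
the last work qubit always is `|0⟩`. -/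
def srcWire (κ : Type) {G : ℕ} (p : Fin (G + 1)) : ι ⊕ ℕ → ι ⊕ (κ ⊕ Fin (G + 1))
  | Sum.inl i => Sum.inl i
  | Sum.inr k => Sum.inr (Sum.inr (if h : k < p then ⟨k, h.trans p.2⟩ else Fin.last G))

/-- The qubit that receives the output of the gate number `p`. -/
def tgtWire (ι κ : Type) {G : ℕ} (p : Fin G) : ι ⊕ (κ ⊕ Fin (G + 1)) :=
  Sum.inr (Sum.inr p.castSucc)

/-- Gate `p` reads inputs, work qubits before `p`, or the spare last one at index `G`, and writes to
`p < G`. The spare qubit supplies the default `false` for references without a value. -/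
theorem srcWire_ne_tgtWire {G : ℕ} (p : Fin G) (i : ι ⊕ ℕ) :
    srcWire κ p.castSucc i ≠ tgtWire ι κ p := by
  rcases i with i | k
  · simp [srcWire, tgtWire]
  · simp only [srcWire, tgtWire]
    intro h
    have h' := Sum.inr_injective (Sum.inr_injective h)
    split_ifs at h' with hk
    · have := congrArg Fin.val h'
      simp at this hk
      omega
    · have := congrArg Fin.val h'
      simp at this
      omega

/-- Reversible evaluation of a Boolean gate. -/
def BGate.quantum (κ : Type) {G : ℕ} (p : Fin G) :
    BGate ι → List (QGate (ι ⊕ (κ ⊕ Fin (G + 1))))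
  | .const b => if b then [.not (tgtWire ι κ p)] else []
  | .not i => [.cnot _ _ (srcWire_ne_tgtWire p i), .not (tgtWire ι κ p)]
  | .and i j => [.toffoli _ _ _ (srcWire_ne_tgtWire p i) (srcWire_ne_tgtWire p j)]
  | .xor i j => [.cnot _ _ (srcWire_ne_tgtWire p i), .cnot _ _ (srcWire_ne_tgtWire p j)]

/-- The configuration of the qubits when the gate outputs `vals` have been computed. -/
def encode (G : ℕ) (x : Bits ι) (y : Bits κ) (vals : List Bool) : Bits (ι ⊕ (κ ⊕ Fin (G + 1))) :=
  Sum.elim x (Sum.elim y fun k => vals.getD k false)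

theorem encode_srcWire {G : ℕ} (x : Bits ι) (y : Bits κ) (vals : List Bool) (p : Fin (G + 1))
    (hp : (p : ℕ) = vals.length) (i : ι ⊕ ℕ) :
    encode G x y vals (srcWire κ p i) = wireValue x vals i := by
  rcases i with i | k
  · rfl
  · simp only [srcWire, encode, wireValue, Sum.elim_inr]
    split_ifs with h
    · rfl
    · rw [List.getD_eq_default _ _ (by simp; omega), List.getD_eq_default _ _ (by omega)]

theorem encode_tgtWire {G : ℕ} (x : Bits ι) (y : Bits κ) (vals : List Bool) (p : Fin G)
    (hp : (p : ℕ) = vals.length) : encode G x y vals (tgtWire ι κ p) = false := by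
  simp only [tgtWire, encode, Sum.elim_inr]
  rw [List.getD_eq_default _ _ (by simp; omega)]

theorem BGate.quantum_isClassical {G : ℕ} (p : Fin G) (g : BGate ι) :
    ∀ q ∈ g.quantum κ p, q.IsClassical := by
  cases g with
  | const b => cases b <;> simp [quantum, QGate.IsClassical]
  | not i => simp [quantum, QGate.IsClassical]
  | and i j => simp [quantum, QGate.IsClassical]
  | xor i j => simp [quantum, QGate.IsClassical]

theorem BGate.length_quantum {G : ℕ} (p : Fin G) (g : BGate ι) :
    (g.quantum κ p).length ≤ 2 := by
  cases g with
  | const b => cases b <;> simp [quantum]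
  | not i => simp [quantum]
  | and i j => simp [quantum]
  | xor i j => simp [quantum]

theorem BCirc.srcWire_ne {m : ℕ} (C : BCirc ι (Fin m)) (k k' : Fin m) :
    srcWire (Fin m) (Fin.last C.gates.length) (C.out k) ≠ Sum.inr (Sum.inl k') := by
  rcases C.out k with i | j <;> simp [srcWire]

/-- Reversible evaluation of a list of gates, the first of which has the number `p`. -/
def quantumGates (κ : Type) (G : ℕ) :
    (gs : List (BGate ι)) → (p : ℕ) → p + gs.length ≤ G → List (QGate (ι ⊕ (κ ⊕ Fin (G + 1))))
  | [], _, _ => []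
  | g :: gs, p, h => g.quantum κ ⟨p, by simp at h; omega⟩ ++
      quantumGates κ G gs (p + 1) (by simp at h; omega)

theorem quantumGates_isClassical {G : ℕ} (gs : List (BGate ι)) (p : ℕ) (h : p + gs.length ≤ G) :
    ∀ q ∈ quantumGates κ G gs p h, q.IsClassical := by
  induction gs generalizing p with
  | nil => simp [quantumGates]
  | cons g gs ih =>
    intro q hq
    rw [quantumGates, List.mem_append] at hq
    exact hq.elim (g.quantum_isClassical _ q) (ih _ _ q)

theorem length_quantumGates {G : ℕ} (gs : List (BGate ι)) (p : ℕ) (h : p + gs.length ≤ G) :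
    (quantumGates κ G gs p h).length ≤ 2 * gs.length := by
  induction gs generalizing p with
  | nil => simp [quantumGates]
  | cons g gs ih =>
    rw [quantumGates, List.length_append, List.length_cons]
    have := g.length_quantum (κ := κ) (⟨p, by simp at h; omega⟩ : Fin G)
    have := ih (p + 1) (by simp at h; omega)
    omega

/-- The qubits of the reversible evaluation of `C`: inputs, outputs and work qubits. -/
abbrev BCirc.QWires {ι : Type} {m : ℕ} (C : BCirc ι (Fin m)) : Type :=
  ι ⊕ (Fin m ⊕ Fin (C.gates.length + 1))

variable {m : ℕ} (C : BCirc ι (Fin m))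

/-- Evaluate all gates of `C` into the work qubits. -/
def BCirc.computeGates : List (QGate C.QWires) :=
  quantumGates (Fin m) C.gates.length C.gates 0 (by simp)

/-- Add the outputs of `C` to the output qubits. -/
def BCirc.copyGates : List (QGate C.QWires) :=
  (List.finRange m).map fun k => .cnot (srcWire (Fin m) (Fin.last C.gates.length) (C.out k))
    (Sum.inr (Sum.inl k)) (C.srcWire_ne k k)

/-- Reversible evaluation of `C`: compute, copy the outputs, uncompute. -/
def BCirc.evalGates : List (QGate C.QWires) :=
  C.computeGates ++ (C.copyGates ++ C.computeGates.reverse)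

theorem BCirc.evalGates_isClassical : ∀ q ∈ C.evalGates, q.IsClassical := by
  intro q hq
  simp only [evalGates, List.mem_append, List.mem_reverse, copyGates, List.mem_map] at hq
  rcases hq with hq | ⟨k, -, rfl⟩ | hq
  · exact quantumGates_isClassical _ _ _ q hq
  · trivial
  · exact quantumGates_isClassical _ _ _ q hq

theorem BCirc.length_evalGates : C.evalGates.length ≤ 4 * C.gates.length + m := by
  have : C.computeGates.length ≤ 2 * C.gates.length := length_quantumGates C.gates 0 (by simp)
  simp only [evalGates, copyGates, List.length_append, List.length_map, List.length_finRange,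
    List.length_reverse]
  omega

variable [DecidableEq ι] [DecidableEq κ]

theorem update_encode {G : ℕ} (x : Bits ι) (y : Bits κ) (vals : List Bool) (p : Fin G)
    (hp : (p : ℕ) = vals.length) (b : Bool) :
    Function.update (encode G x y vals) (tgtWire ι κ p) b = encode G x y (vals ++ [b]) := by
  funext w
  by_cases hw : w = tgtWire ι κ p
  · subst hw
    simp [tgtWire, encode, hp]
  · rw [Function.update_of_ne hw]
    rcases w with w | w | k
    · rfl
    · rfl
    · have hk : (k : ℕ) ≠ vals.length := by
        rintro h
        apply hw
        simp only [tgtWire, Sum.inr.injEq]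
        ext
        simp [h, hp]
      simp only [encode, Sum.elim_inr]
      rcases lt_or_gt_of_ne hk with h | h
      · simp [List.getElem?_append_left h]
      · rw [List.getD_eq_default _ _ (by omega), List.getD_eq_default _ _ (by simp; omega)]

theorem BGate.permList_quantum {G : ℕ} (x : Bits ι) (y : Bits κ) (vals : List Bool) (p : Fin G)
    (hp : (p : ℕ) = vals.length) (g : BGate ι) :
    permList (g.quantum κ p) (encode G x y vals) = encode G x y (evalStep x vals g) := by
  have hs := encode_srcWire x y vals p.castSucc (by simpa using hp)
  have ht := encode_tgtWire x y vals p hp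
  have hu := update_encode x y vals p hp
  have hne := srcWire_ne_tgtWire (ι := ι) (κ := κ) p
  cases g with
  | const b =>
    cases b
    -- No gate is applied for the constant `false`: appending `false` leaves the configuration
    -- unchanged, as unset work qubits are already 0.
    · have := hu false
      rw [← ht, Function.update_eq_self, ht] at this
      exact this
    · simp [quantum, evalStep, BGate.eval, QGate.perm, ← hu, ht]
  | not i => simp [quantum, evalStep, BGate.eval, QGate.perm, ← hu, ht, hs]
  | and i j => simp [quantum, evalStep, BGate.eval, QGate.perm, ← hu, ht, hs]
  | xor i j => simp [quantum, evalStep, BGate.eval, QGate.perm, ← hu, ht, hs, hne]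

theorem permList_quantumGates {G : ℕ} (x : Bits ι) (y : Bits κ) (gs : List (BGate ι)) (p : ℕ)
    (h : p + gs.length ≤ G) (vals : List Bool) (hp : p = vals.length) :
    permList (quantumGates κ G gs p h) (encode G x y vals) =
      encode G x y (gs.foldl (evalStep x) vals) := by
  induction gs generalizing p vals with
  | nil => rfl
  | cons g gs ih =>
    rw [quantumGates, permList_append, BGate.permList_quantum x y vals _ hp,
      ih (p + 1) (by simp at h; omega) (evalStep x vals g) (by simp [evalStep, hp]),
      List.foldl_cons]

theorem BCirc.permList_copyGates (x : Bits ι) (y : Bits (Fin m)) :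
    permList C.copyGates (encode C.gates.length x y (C.run x)) =
      encode C.gates.length x (fun k => Bool.xor (y k) (C.eval x k)) (C.run x) := by
  funext w
  rcases w with i | k | a
  · exact permList_cnots_of_ne _ _ C.srcWire_ne _ _ _ (by simp)
  · refine (permList_cnots_target _ (fun k => (Sum.inr (Sum.inl k) : C.QWires)) C.srcWire_ne
      (fun a b h => by simpa using h) _ (List.nodup_finRange m) _ k (by simp)).trans ?_
    rw [encode_srcWire _ _ _ _ (by simp [C.length_run])]
    rfl
  · exact permList_cnots_of_ne _ _ C.srcWire_ne _ _ _ (by simp)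

/-- The work qubits hold `C.run x` whatever the output register contains. The computation can
therefore be undone after copying, with the new register contents in place of `y`. -/
theorem BCirc.permList_evalGates (x : Bits ι) (y : Bits (Fin m)) :
    permList C.evalGates (Sum.elim x (Sum.elim y fun _ => false)) =
      Sum.elim x (Sum.elim (fun k => Bool.xor (y k) (C.eval x k)) fun _ => false) := by
  have h : ∀ y : Bits (Fin m), permList C.computeGates
      (Sum.elim x (Sum.elim y fun _ => false)) = encode C.gates.length x y (C.run x) := fun y => by
    have := permList_quantumGates (G := C.gates.length) x y C.gates 0 (by simp) [] rfl
    rw [← C.run_eq] at this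
    rw [← this]
    rfl
  rw [evalGates, permList_append, permList_append, h, permList_copyGates, ← h,
    permList_reverse_permList]

theorem BCirc.actList_evalGates (ψ : Bits C.QWires → ℂ) (x : Bits ι) (y : Bits (Fin m)) :
    actList C.evalGates ψ (Sum.elim x (Sum.elim y fun _ => false)) =
      ψ (Sum.elim x (Sum.elim (fun k => Bool.xor (y k) (C.eval x k)) fun _ => false)) := by
  rw [← actList_permList C.evalGates C.evalGates_isClassical ψ, permList_evalGates]
  simp

/-- Clean work qubits stay clean. A configuration with dirty work qubits thus comes from a dirty
one, where `ψ` vanishes. -/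
theorem BCirc.actList_evalGates_eq_zero (ψ : Bits C.QWires → ℂ)
    (hψ : ∀ x y a, a ≠ (fun _ => false) → ψ (Sum.elim x (Sum.elim y a)) = 0)
    (x : Bits ι) (y : Bits (Fin m)) (a : Bits (Fin (C.gates.length + 1)))
    (ha : a ≠ fun _ => false) : actList C.evalGates ψ (Sum.elim x (Sum.elim y a)) = 0 := by
  obtain ⟨z, hz⟩ : ∃ z, permList C.evalGates z = Sum.elim x (Sum.elim y a) :=
    ⟨_, permList_permList_reverse _ _⟩
  rw [← hz, actList_permList C.evalGates C.evalGates_isClassical]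
  obtain ⟨x', y', a', rfl⟩ : ∃ x' y' a', z = Sum.elim x' (Sum.elim y' a') :=
    ⟨z ∘ Sum.inl, z ∘ Sum.inr ∘ Sum.inl, z ∘ Sum.inr ∘ Sum.inr, by
      funext w; rcases w with w | w | w <;> rfl⟩
  refine hψ _ _ _ ?_
  rintro rfl
  rw [permList_evalGates] at hz
  exact ha (funext fun k => (congrFun hz (Sum.inr (Sum.inr k))).symm)

end Reversible

/-! ### The receiver -/

section Receiver

variable {lp n m : ℕ}

/-- The value of `C` on parameters `pp`, bit `b` and string `x`. -/
def BCirc.evalAt (C : BCirc (Fin lp ⊕ (Unit ⊕ Fin n)) (Fin m)) (pp : Bits (Fin lp)) (b : Bool)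
    (x : Bits (Fin n)) : Bits (Fin m) := C.eval (Sum.elim pp (Sum.elim (fun _ => b) x))

variable (Prep : QCirc (Fin lp) (Fin n)) (C : BCirc (Fin lp ⊕ (Unit ⊕ Fin n)) (Fin m))

/-- The ancillas of the receiver: the bit `b`, the qubits of the state preparation, the image and
the work qubits for the evaluation of `C`. -/
abbrev RcvAnc {lp n m : ℕ} (Prep : QCirc (Fin lp) (Fin n))
    (C : BCirc (Fin lp ⊕ (Unit ⊕ Fin n)) (Fin m)) : Type :=
  Unit ⊕ ((Fin n ⊕ Fin Prep.gar) ⊕ (Fin m ⊕ Fin (C.gates.length + 1)))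

/-- A configuration of the qubits of the receiver. -/
def rcvConfig {Prep : QCirc (Fin lp) (Fin n)} {C : BCirc (Fin lp ⊕ (Unit ⊕ Fin n)) (Fin m)}
    (pp : Bits (Fin lp)) (q : Bool) (u : Bits (Fin n ⊕ Fin Prep.gar)) (y : Bits (Fin m))
    (a : Bits (Fin (C.gates.length + 1))) : Bits (Fin lp ⊕ RcvAnc Prep C) :=
  Sum.elim pp (Sum.elim (fun _ => q) (Sum.elim u (Sum.elim y a)))

/-- The qubits of the state preparation. -/
def prepWire (w : Fin lp ⊕ Fin Prep.anc) : Fin lp ⊕ RcvAnc Prep C :=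
  Sum.inr (Sum.inr (Sum.inl (Prep.wires w)))

theorem prepWire_injective : Function.Injective (prepWire Prep C) := fun a b h => by
  simpa [prepWire] using h

/-- The qubits of the evaluation of `C`. -/
def evalWire : C.QWires → Fin lp ⊕ RcvAnc Prep C
  | Sum.inl (Sum.inl i) => Sum.inl i
  | Sum.inl (Sum.inr (Sum.inl _)) => Sum.inr (Sum.inl ())
  | Sum.inl (Sum.inr (Sum.inr i)) => Sum.inr (Sum.inr (Sum.inl (Sum.inl i)))
  | Sum.inr w => Sum.inr (Sum.inr (Sum.inr w))

theorem evalWire_injective : Function.Injective (evalWire Prep C) := by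
  rintro ((a | a | a) | a) ((b | b | b) | b) h <;> simp_all [evalWire]

/-- The qubits of the string `x`. -/
def strWire (i : Fin n) : Fin lp ⊕ RcvAnc Prep C := Sum.inr (Sum.inr (Sum.inl (Sum.inl i)))

theorem strWire_injective : Function.Injective (strWire Prep C) := fun a b h => by
  simpa [strWire] using h

/-- Copy the parameters to the input of the state preparation. -/
def copyParamGates : List (QGate (Fin lp ⊕ RcvAnc Prep C)) :=
  (List.finRange lp).map fun i => .cnot (Sum.inl i) (prepWire Prep C (Sum.inl i)) (by
    simp [prepWire])

/-- The gates of the receiver. -/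
def rcvGates : List (QGate (Fin lp ⊕ RcvAnc Prep C)) :=
  copyParamGates Prep C ++
  (Prep.gates.map (QGate.map _ (prepWire_injective Prep C)) ++
  ([QGate.hadamard (Sum.inr (Sum.inl ()))] ++
  (C.evalGates.map (QGate.map _ (evalWire_injective Prep C)) ++
  (hadamardLayer n).map (QGate.map _ (strWire_injective Prep C)))))

/-- The preparation gets its own copy of `pp`, since the original is needed to evaluate `C`. Its
qubits are named by their roles at the end of `Prep`, hence the inverse of `Prep.wires`. -/
theorem permList_copyParamGates (pp : Bits (Fin lp)) :
    permList (copyParamGates Prep C) (Sum.elim pp fun _ => false) =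
      rcvConfig pp false (Sum.elim pp (fun _ => false) ∘ Prep.wires.symm) (fun _ => false)
        (fun _ => false) := by
  have hne : ∀ k k', (Sum.inl k : Fin lp ⊕ RcvAnc Prep C) ≠ prepWire Prep C (Sum.inl k') := by
    simp [prepWire]
  funext w
  rcases w with w | w | w | w | w
  · exact permList_cnots_of_ne _ _ hne _ _ _ (by simp [prepWire])
  · exact permList_cnots_of_ne _ _ hne _ _ _ (by simp [prepWire])
  · obtain ⟨v, rfl⟩ := Prep.wires.surjective w
    rcases v with i | v
    · refine (permList_cnots_target _ (fun k => prepWire Prep C (Sum.inl k)) hne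
        (fun a b h => by simpa [prepWire] using h) _ (List.nodup_finRange lp) _ i (by simp)).trans ?_
      simp [rcvConfig, prepWire]
    · refine (permList_cnots_of_ne _ _ hne _ _ _ (by simp [prepWire])).trans ?_
      simp [rcvConfig]
  · exact permList_cnots_of_ne _ _ hne _ _ _ (by simp [prepWire])
  · exact permList_cnots_of_ne _ _ hne _ _ _ (by simp [prepWire])

theorem rcvConfig_inj {pp pp' : Bits (Fin lp)} {q q' : Bool} {u u' : Bits (Fin n ⊕ Fin Prep.gar)}
    {y y' : Bits (Fin m)} {a a' : Bits (Fin (C.gates.length + 1))} :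
    (rcvConfig pp q u y a : Bits (Fin lp ⊕ RcvAnc Prep C)) = rcvConfig pp' q' u' y' a' ↔
      pp = pp' ∧ q = q' ∧ u = u' ∧ y = y' ∧ a = a' := by
  refine ⟨fun h => ⟨?_, ?_, ?_, ?_, ?_⟩, by rintro ⟨rfl, rfl, rfl, rfl, rfl⟩; rfl⟩
  · exact funext fun i => congrFun h (Sum.inl i)
  · exact congrFun h (Sum.inr (Sum.inl ()))
  · exact funext fun i => congrFun h (Sum.inr (Sum.inr (Sum.inl i)))
  · exact funext fun i => congrFun h (Sum.inr (Sum.inr (Sum.inr (Sum.inl i))))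
  · exact funext fun i => congrFun h (Sum.inr (Sum.inr (Sum.inr (Sum.inr i))))

/-- The other qubits are frozen: along each fixed value of them, the gates act as `Prep`, either on
its initial basis state or on the zero vector. -/
theorem actList_prepWire (pp pp' : Bits (Fin lp)) (q : Bool) (u : Bits (Fin n ⊕ Fin Prep.gar))
    (y : Bits (Fin m)) (a : Bits (Fin (C.gates.length + 1))) :
    actList (Prep.gates.map (QGate.map _ (prepWire_injective Prep C)))
      (basisState (rcvConfig pp false (Sum.elim pp (fun _ => false) ∘ Prep.wires.symm)
        (fun _ => false) (fun _ => false))) (rcvConfig pp' q u y a) =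
      if pp' = pp ∧ q = false ∧ y = (fun _ => false) ∧ a = (fun _ => false) then
        Prep.final pp (u ∘ Prep.wires) else 0 := by
  have h := congrFun (actList_map _ (prepWire_injective Prep C)
    (fun v => rcvConfig pp' q (v ∘ Prep.wires.symm) y a)
    (fun v i => by simp [rcvConfig, prepWire])
    (fun v i b => by
      rw [Function.update_comp_equiv]
      funext w
      rcases w with w | w | w | w <;> simp only [rcvConfig, prepWire, Function.update_apply, Sum.elim_inl,
        Sum.elim_inr, reduceCtorEq, if_false, Sum.inr.injEq, Sum.inl.injEq,
        Equiv.symm_symm])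
    Prep.gates (basisState (rcvConfig pp false (Sum.elim pp (fun _ => false) ∘ Prep.wires.symm)
        (fun _ => false) (fun _ => false)))) (u ∘ Prep.wires)
  have hu : (u ∘ Prep.wires) ∘ Prep.wires.symm = u := by
    rw [Function.comp_assoc, Equiv.self_comp_symm, Function.comp_id]
  simp only [Function.comp_apply] at h
  change _ = actList Prep.gates _ _ at h
  rw [hu] at h
  rw [h, QCirc.final_eq]
  split_ifs with hc
  · congr 1
    funext v
    have : v ∘ Prep.wires.symm = Sum.elim pp (fun _ => false) ∘ Prep.wires.symm ↔
        v = Sum.elim pp fun _ => false := Prep.wires.symm.surjective.injective_comp_right.eq_iff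
    simp only [Function.comp_apply, basisState, rcvConfig_inj, hc, this, true_and, and_true]
  · have : (basisState (rcvConfig pp false (Sum.elim pp (fun _ => false) ∘ Prep.wires.symm)
        (fun _ => false) (fun _ => false))) ∘
        (fun v => (rcvConfig pp' q (v ∘ Prep.wires.symm) y a : Bits (Fin lp ⊕ RcvAnc Prep C))) =
        fun _ => 0 := by
      funext v
      simp only [Function.comp_apply, basisState, rcvConfig_inj]
      rw [if_neg]
      rintro ⟨h1, h2, -, h3, h4⟩
      exact hc ⟨h1, h2, h3, h4⟩
    rw [this, actList_zero]

/-- The control bit is still 0, so only one amplitude enters and no sign appears. -/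
theorem actList_hadamardBit (φ : Bits (Fin lp ⊕ RcvAnc Prep C) → ℂ)
    (pp : Bits (Fin lp)) (q : Bool) (u : Bits (Fin n ⊕ Fin Prep.gar))
    (y : Bits (Fin m)) (a : Bits (Fin (C.gates.length + 1)))
    (hφ : φ (rcvConfig pp true u y a) = 0) :
    actList [QGate.hadamard (Sum.inr (Sum.inl ()))] φ (rcvConfig pp q u y a) =
      φ (rcvConfig pp false u y a) / (Real.sqrt 2 : ℂ) := by
  have hup : ∀ b, Function.update (rcvConfig pp q u y a : Bits (Fin lp ⊕ RcvAnc Prep C))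
      (Sum.inr (Sum.inl ())) b = rcvConfig pp b u y a := fun b => by
    funext w
    rcases w with w | w | w <;> simp [rcvConfig]
  simp only [actList_cons, actList_nil, QGate.act, hup, hφ, mul_zero, add_zero]

theorem actList_evalWire (φ : Bits (Fin lp ⊕ RcvAnc Prep C) → ℂ)
    (hφ : ∀ pp q u y a, a ≠ (fun _ => false) → φ (rcvConfig pp q u y a) = 0)
    (pp : Bits (Fin lp)) (q : Bool) (x : Bits (Fin n)) (g : Bits (Fin Prep.gar))
    (y : Bits (Fin m)) (a : Bits (Fin (C.gates.length + 1))) :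
    actList (C.evalGates.map (QGate.map _ (evalWire_injective Prep C))) φ
      (rcvConfig pp q (Sum.elim x g) y a) = if a = (fun _ => false) then
        φ (rcvConfig pp q (Sum.elim x g) (fun k => Bool.xor (y k) (C.evalAt pp q x k)) a) else 0 := by
  have h := fun v => congrFun (actList_map _ (evalWire_injective Prep C)
    (fun v => rcvConfig (v ∘ Sum.inl ∘ Sum.inl) (v (Sum.inl (Sum.inr (Sum.inl ()))))
      (Sum.elim (v ∘ Sum.inl ∘ Sum.inr ∘ Sum.inr) g) (v ∘ Sum.inr ∘ Sum.inl)
      (v ∘ Sum.inr ∘ Sum.inr))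
    (fun v i => by rcases i with (i | i | i) | i | i <;> simp [rcvConfig, evalWire])
    (fun v i b => by
      funext w
      rcases i with (i | i | i) | i | i <;> rcases w with w | w | (w | w) | w | w <;>
        simp [rcvConfig, evalWire, Function.update_apply])
    C.evalGates φ) v
  have h' := h (Sum.elim (Sum.elim pp (Sum.elim (fun _ => q) x)) (Sum.elim y a))
  rw [Function.comp_apply] at h'
  refine Eq.trans h' ?_
  split_ifs with ha
  · subst ha
    rw [BCirc.actList_evalGates]
    rfl
  · refine BCirc.actList_evalGates_eq_zero C _ (fun x' y' a' ha' => hφ _ _ _ _ _ ha') _ _ _ ha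

theorem actList_strWire (φ : Bits (Fin lp ⊕ RcvAnc Prep C) → ℂ)
    (pp : Bits (Fin lp)) (q : Bool) (d : Bits (Fin n)) (g : Bits (Fin Prep.gar))
    (y : Bits (Fin m)) (a : Bits (Fin (C.gates.length + 1))) :
    actList ((hadamardLayer n).map (QGate.map _ (strWire_injective Prep C))) φ
      (rcvConfig pp q (Sum.elim d g) y a) = ((Real.sqrt 2 : ℂ) ^ n)⁻¹ *
      ∑ x, (DualModeFamily.phaseSign d x : ℂ) * φ (rcvConfig pp q (Sum.elim x g) y a) := by
  have h := congrFun (actList_map _ (strWire_injective Prep C)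
    (fun v => rcvConfig pp q (Sum.elim v g) y a)
    (fun v i => by simp [rcvConfig, strWire])
    (fun v i b => by
      funext w
      rcases w with w | w | (w | w) | w <;> simp only [rcvConfig, strWire, Function.update_apply, Sum.elim_inl,
        Sum.elim_inr, reduceCtorEq, if_false, Sum.inr.injEq, Sum.inl.injEq])
    (hadamardLayer n) φ) d
  rw [Function.comp_apply] at h
  rw [h, actList_hadamardLayer]
  rfl

/-- The map taking the state of the string `x` to the unnormalized state of the bit `b` after the
outcomes `y` and `d`. -/
noncomputable def measMatrix (pp : Bits (Fin lp)) (y : Bits (Fin m)) (d : Bits (Fin n)) :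
    Matrix Bool (Bits (Fin n)) ℂ :=
  Matrix.of fun b x => ((Real.sqrt 2 : ℂ) ^ (n + 1))⁻¹ *
    ((DualModeFamily.phaseSign d x : ℂ) * if C.evalAt pp b x = y then 1 else 0)

theorem actList_rcvGates (pp pp' : Bits (Fin lp)) (q : Bool) (d : Bits (Fin n))
    (g : Bits (Fin Prep.gar)) (y : Bits (Fin m)) (a : Bits (Fin (C.gates.length + 1))) :
    actList (rcvGates Prep C) (basisState (Sum.elim pp fun _ => false))
      (rcvConfig pp' q (Sum.elim d g) y a) =
      if pp' = pp ∧ a = (fun _ => false) then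
        ∑ x, measMatrix C pp y d q x * Prep.slice pp g x else 0 := by
  have hcl : ∀ g ∈ copyParamGates Prep C, g.IsClassical := by
    intro g hg
    simp only [copyParamGates, List.mem_map] at hg
    obtain ⟨i, -, rfl⟩ := hg
    trivial
  have hH := fun pp' q u y a => actList_hadamardBit Prep C _ pp' q u y a
    ((actList_prepWire Prep C pp pp' true u y a).trans (by simp))
  simp only [actList_prepWire] at hH
  rw [rcvGates, actList_append, actList_append, actList_append, actList_append,
    actList_basisState _ hcl, permList_copyParamGates, actList_strWire, Finset.mul_sum]
  split_ifs with hc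
  · obtain ⟨rfl, rfl⟩ := hc
    refine Finset.sum_congr rfl fun x _ => ?_
    rw [actList_evalWire _ _ _ fun pp' q u y a ha => by rw [hH, if_neg (by tauto), zero_div]]
    rw [if_pos rfl, hH, measMatrix, Matrix.of_apply]
    -- The image register started at 0, so it contains `y` after the evaluation exactly when the
    -- value is `y`.
    have hxor : (fun k => Bool.xor (y k) (C.evalAt pp' q x k)) = (fun _ => false) ↔
        C.evalAt pp' q x = y := by
      simp only [funext_iff]
      exact forall_congr' fun k => by cases y k <;> cases C.evalAt pp' q x k <;> simp
    simp only [hxor, true_and, and_true]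
    split_ifs
    · rw [pow_succ, mul_inv, QCirc.slice]
      ring
    · ring
  · refine Finset.sum_eq_zero fun x _ => ?_
    rw [actList_evalWire _ _ _ fun pp' q u y a ha => by rw [hH, if_neg (by tauto), zero_div]]
    split_ifs with ha
    · rw [hH, if_neg (by tauto)]; simp
    · simp

/-- The qubits of the receiver, split into the output bit, its message `(y, d)` and the discarded
ones. -/
def rcvWires : Fin lp ⊕ RcvAnc Prep C ≃
    (Unit ⊕ Fin (m + n)) ⊕ (Fin lp ⊕ (Fin Prep.gar ⊕ Fin (C.gates.length + 1))) :=
  Equiv.trans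
    { toFun := fun
        | Sum.inl i => Sum.inr (Sum.inl i)
        | Sum.inr (Sum.inl i) => Sum.inl (Sum.inl i)
        | Sum.inr (Sum.inr (Sum.inl (Sum.inl i))) => Sum.inl (Sum.inr (Sum.inr i))
        | Sum.inr (Sum.inr (Sum.inl (Sum.inr i))) => Sum.inr (Sum.inr (Sum.inl i))
        | Sum.inr (Sum.inr (Sum.inr (Sum.inl i))) => Sum.inl (Sum.inr (Sum.inl i))
        | Sum.inr (Sum.inr (Sum.inr (Sum.inr i))) => Sum.inr (Sum.inr (Sum.inr i))
      invFun := fun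
        | Sum.inr (Sum.inl i) => Sum.inl i
        | Sum.inl (Sum.inl i) => Sum.inr (Sum.inl i)
        | Sum.inl (Sum.inr (Sum.inr i)) => Sum.inr (Sum.inr (Sum.inl (Sum.inl i)))
        | Sum.inr (Sum.inr (Sum.inl i)) => Sum.inr (Sum.inr (Sum.inl (Sum.inr i)))
        | Sum.inl (Sum.inr (Sum.inl i)) => Sum.inr (Sum.inr (Sum.inr (Sum.inl i)))
        | Sum.inr (Sum.inr (Sum.inr i)) => Sum.inr (Sum.inr (Sum.inr (Sum.inr i)))
      left_inv := by rintro (i | i | (i | i) | i | i) <;> rfl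
      right_inv := by rintro ((i | i | i) | i | i | i) <;> rfl }
    (Equiv.sumCongr (Equiv.sumCongr (Equiv.refl Unit) finSumFinEquiv) (Equiv.refl _))

theorem comp_rcvWires (pp : Bits (Fin lp)) (q : Bool) (d : Bits (Fin n))
    (g : Bits (Fin Prep.gar)) (y : Bits (Fin m)) (a : Bits (Fin (C.gates.length + 1))) :
    Sum.elim (Sum.elim (fun _ => q) (Fin.append y d)) (Sum.elim pp (Sum.elim g a)) ∘
      rcvWires Prep C = rcvConfig pp q (Sum.elim d g) y a := by
  funext w
  rcases w with w | w | (w | w) | w | w <;> simp [rcvWires, rcvConfig]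

/-- The circuit of the receiver. -/
noncomputable def rcvCirc : QCirc (Fin lp) (Unit ⊕ Fin (m + n)) :=
  QCirc.ofLabels (rcvGates Prep C) (rcvWires Prep C)

/-- The discarded copy of `pp` and the work qubits have fixed final values, so tracing them out
contributes one term. Only the sum over the garbage of `Prep` remains, and it produces the mixed
state `Prep.density`. -/
theorem rcvCirc_density (pp : Bits (Fin lp)) (y : Bits (Fin m)) (d : Bits (Fin n)) (c c' : Bool) :
    (rcvCirc Prep C).density pp (Sum.elim (fun _ => c) (Fin.append y d))
      (Sum.elim (fun _ => c') (Fin.append y d)) =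
      (measMatrix C pp y d * Prep.density pp * (measMatrix C pp y d).conjTranspose) c c' := by
  rw [rcvCirc, QCirc.density_ofLabels]
  have hg : ∀ G : Bits (Fin lp ⊕ (Fin Prep.gar ⊕ Fin (C.gates.length + 1))),
      G = Sum.elim (G ∘ Sum.inl) (Sum.elim (G ∘ Sum.inr ∘ Sum.inl) (G ∘ Sum.inr ∘ Sum.inr)) :=
    fun G => by funext w; rcases w with w | w | w <;> rfl
  have hterm : ∀ (G : Bits (Fin lp ⊕ (Fin Prep.gar ⊕ Fin (C.gates.length + 1)))) (c : Bool),
      actList (rcvGates Prep C) (basisState (Sum.elim pp fun _ => false))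
        (Sum.elim (Sum.elim (fun _ => c) (Fin.append y d)) G ∘ rcvWires Prep C) =
      if G ∘ Sum.inl = pp ∧ G ∘ Sum.inr ∘ Sum.inr = (fun _ => false) then
        ∑ x, measMatrix C pp y d c x * Prep.slice pp (G ∘ Sum.inr ∘ Sum.inl) x else 0 :=
    fun G c => by
      conv_lhs => rw [hg G]
      rw [comp_rcvWires, actList_rcvGates]
  simp only [hterm]
  have hinj : Function.Injective fun g : Bits (Fin Prep.gar) =>
      (Sum.elim pp (Sum.elim g fun _ => false) :
        Bits (Fin lp ⊕ (Fin Prep.gar ⊕ Fin (C.gates.length + 1)))) := fun g g' h =>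
    funext fun i => congrFun h (Sum.inr (Sum.inl i))
  rw [← Fintype.sum_of_injective _ hinj
    (fun g => (∑ x, measMatrix C pp y d c x * Prep.slice pp g x) *
      star (∑ x, measMatrix C pp y d c' x * Prep.slice pp g x)) _ ?_ ?_]
  · simp only [Matrix.mul_apply, Matrix.conjTranspose_apply, QCirc.density_apply, Finset.mul_sum,
      Finset.sum_mul, star_sum, star_mul']
    rw [Finset.sum_comm]
    refine Finset.sum_congr rfl fun x _ => ?_
    rw [Finset.sum_comm]
    refine Finset.sum_congr rfl fun x' _ => Finset.sum_congr rfl fun g _ => ?_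
    ring
  · intro G hG
    rw [if_neg, zero_mul]
    rintro ⟨h1, h2⟩
    refine hG ⟨G ∘ Sum.inr ∘ Sum.inl, ?_⟩
    rw [hg G, h1, h2]
    rfl
  · intro g
    have h1 : (Sum.elim pp (Sum.elim g fun _ => false) :
        Bits (Fin lp ⊕ (Fin Prep.gar ⊕ Fin (C.gates.length + 1)))) ∘ Sum.inl = pp := rfl
    have h2 : (Sum.elim pp (Sum.elim g fun _ => false) :
        Bits (Fin lp ⊕ (Fin Prep.gar ⊕ Fin (C.gates.length + 1)))) ∘ Sum.inr ∘ Sum.inr =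
        fun _ => false := rfl
    simp only [h1, h2, and_self, if_true]
    rfl

theorem rcvCirc_size :
    (rcvCirc Prep C).size ≤ 2 * Prep.size + 5 * C.size + C.size + C.size + 4 := by
  have h1 := C.length_evalGates
  -- The receiver counts the preparation qubits by outputs and garbage, `Prep.size` by inputs and
  -- ancillas.
  have h2 : lp + Prep.anc = n + Prep.gar := by
    simpa using Fintype.card_congr Prep.wires
  simp only [QCirc.size, BCirc.size, rcvCirc, QCirc.ofLabels, rcvGates, copyParamGates,
    hadamardLayer, Fintype.card_sum, Fintype.card_fin, Fintype.card_unit, List.length_append,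
    List.length_map, List.length_finRange, List.length_cons, List.length_nil]
  omega

end Receiver

/-! ### Trace norm -/

section TraceNorm

variable {α β : Type} [Fintype α] [DecidableEq α] [Fintype β]

/-- A contraction `R` satisfies `|Tr (R A R†)| ≤ ‖A‖₁`. -/
theorem norm_trace_conj_le_traceNorm (R : Matrix β α ℂ)
    (hR : ∀ ψ : α → ℂ, ∑ k, ‖R.mulVec ψ k‖ ^ 2 ≤ ∑ x, ‖ψ x‖ ^ 2) (A : Matrix α α ℂ) :
    ‖(R * A * R.conjTranspose).trace‖ ≤ traceNorm A := by
  set h := Matrix.isHermitian_conjTranspose_mul_self A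
  set U : Matrix α α ℂ := (h.eigenvectorUnitary).1 with hU
  have hUU : U * U.conjTranspose = 1 := Unitary.coe_mul_star_self h.eigenvectorUnitary
  have hUU' : U.conjTranspose * U = 1 := Unitary.coe_star_mul_self h.eigenvectorUnitary
  -- In an orthonormal eigenbasis `uᵢ` of `A† A`, the trace is the sum of the inner products of `R A
  -- uᵢ` with `R uᵢ`. Cauchy–Schwarz bounds each by `‖A uᵢ‖ ‖uᵢ‖`, where `‖A uᵢ‖²` is the `i`-th
  -- eigenvalue.
  have htr : (R * A * R.conjTranspose).trace =
      ∑ i, ∑ k, (R * (A * U)) k i * star ((R * U) k i) := by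
    have : R * A * R.conjTranspose = (R * (A * U)) * (R * U).conjTranspose := by
      rw [Matrix.conjTranspose_mul, Matrix.mul_assoc R, Matrix.mul_assoc R, Matrix.mul_assoc A,
        ← Matrix.mul_assoc U, hUU, Matrix.one_mul]
    rw [this, Matrix.trace, Finset.sum_comm]
    rfl
  have hmul : ∀ (B : Matrix α α ℂ) i, ∑ k, ‖(R * B) k i‖ ^ 2 ≤ ∑ x, ‖B x i‖ ^ 2 := fun B i =>
    hR fun x => B x i
  have hnorm : ∀ (B : Matrix α α ℂ) i, ((∑ x, ‖B x i‖ ^ 2 : ℝ) : ℂ) = (B.conjTranspose * B) i i := by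
    intro B i
    rw [Matrix.mul_apply]
    push_cast
    refine Finset.sum_congr rfl fun x _ => ?_
    rw [Matrix.conjTranspose_apply, Complex.star_def, Complex.conj_mul']
  have hU1 : ∀ i, ∑ x, ‖U x i‖ ^ 2 = 1 := fun i => by
    have := hnorm U i
    rw [hUU', Matrix.one_apply_eq] at this
    exact_mod_cast this
  have hA : ∀ i, ∑ x, ‖(A * U) x i‖ ^ 2 = h.eigenvalues i := fun i => by
    have := hnorm (A * U) i
    rw [Matrix.conjTranspose_mul, Matrix.mul_assoc, ← Matrix.mul_assoc A.conjTranspose,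
      Matrix.mul_apply] at this
    have hcol : ∀ x, (A.conjTranspose * A * U) x i = h.eigenvalues i * U x i := fun x => by
      have := congrFun (h.mulVec_eigenvectorBasis i) x
      simpa [Matrix.mulVec, dotProduct, Matrix.mul_apply, hU] using this
    simp only [hcol, mul_left_comm] at this
    rw [← Finset.mul_sum, ← Matrix.mul_apply, hUU', Matrix.one_apply_eq, mul_one] at this
    exact_mod_cast this
  rw [htr, traceNorm]
  refine (norm_sum_le _ _).trans (Finset.sum_le_sum fun i _ => ?_)
  calc ‖∑ k, (R * (A * U)) k i * star ((R * U) k i)‖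
      ≤ ∑ k, ‖(R * (A * U)) k i‖ * ‖(R * U) k i‖ := by
        refine (norm_sum_le _ _).trans (le_of_eq (Finset.sum_congr rfl fun k _ => ?_))
        rw [norm_mul, norm_star]
    _ ≤ Real.sqrt (∑ k, ‖(R * (A * U)) k i‖ ^ 2) * Real.sqrt (∑ k, ‖(R * U) k i‖ ^ 2) :=
        Real.sum_mul_le_sqrt_mul_sqrt _ _ _
    _ ≤ Real.sqrt (h.eigenvalues i) * Real.sqrt 1 := by
        gcongr
        · exact (hmul _ i).trans (hA i).le
        · exact (hmul _ i).trans (hU1 i).le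
    _ = Real.sqrt (h.eigenvalues i) := by simp

end TraceNorm

/-! ### Expectations over randomized circuits -/

section Expect

variable {ι κ : Type} (C : RCirc ι κ) (x : Bits ι)

/-- The comparison is required only at outputs that occur, so facts about possible public parameters
can be used under the expectation. -/
theorem RCirc.expect_mono {g h : Bits κ → ℝ} (H : ∀ r, g (C.eval x r) ≤ h (C.eval x r)) :
    C.expect x g ≤ C.expect x h := by
  unfold RCirc.expect
  gcongr with r
  exact H r

theorem RCirc.expect_const (a : ℝ) : C.expect x (fun _ => a) = a := by
  simp [RCirc.expect]

theorem RCirc.expect_sub (g h : Bits κ → ℝ) :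
    C.expect x (fun z => g z - h z) = C.expect x g - C.expect x h := by
  simp [RCirc.expect, Finset.sum_sub_distrib, sub_div]

theorem RCirc.expect_mul_left (a : ℝ) (g : Bits κ → ℝ) :
    C.expect x (fun z => a * g z) = a * C.expect x g := by
  simp [RCirc.expect, ← Finset.mul_sum, mul_div_assoc]

theorem RCirc.expect_sum {β : Type} (s : Finset β) (g : β → Bits κ → ℝ) :
    C.expect x (fun z => ∑ i ∈ s, g i z) = ∑ i ∈ s, C.expect x (g i) := by
  simp only [RCirc.expect, ← Finset.sum_div]
  rw [Finset.sum_comm]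

end Expect

/-! ### Overlaps with the target states -/

/-- The state `H^b |s⟩`. -/
noncomputable def targetVec (b s c : Bool) : ℝ :=
  if b then (if c && s then -1 else 1) / Real.sqrt 2 else if c = s then 1 else 0

theorem targetVec_sq (b s : Bool) : targetVec b s false ^ 2 + targetVec b s true ^ 2 = 1 := by
  cases b <;> cases s <;> simp [targetVec, div_pow] <;> norm_num

/-- The squared overlap of `ρ` with `H^b |s⟩`. -/
noncomputable def overlapSq (b s : Bool) (ρ : Matrix Bool Bool ℂ) : ℝ :=
  (∑ c, ∑ c', (targetVec b s c : ℂ) * (targetVec b s c' : ℂ) * ρ c c').re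

/-- `projOSP b` is block diagonal in `s`, each block being the rank-one projection on the real
vector `targetVec b s`; the factor `ketbra s` selects one block. -/
theorem trace_projOSP_mul (b s : Bool) (ρ : Matrix Bool Bool ℂ) :
    (projOSP b * Matrix.kronecker (ketbra s) ρ).trace =
      ∑ c, ∑ c', (targetVec b s c : ℂ) * (targetVec b s c' : ℂ) * ρ c c' := by
  have hp : projOSP b = Matrix.of fun p q : Bool × Bool =>
      if p.1 = q.1 then ((targetVec b p.1 p.2 : ℂ) * (targetVec b p.1 q.2 : ℂ)) else 0 := by
    ext ⟨p, c⟩ ⟨q, c'⟩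
    cases b <;> cases p <;> cases q <;> cases c <;> cases c' <;>
      simp [projOSP, ketbra, hadamardMatrix, targetVec, Matrix.mul_apply, Matrix.single]
  rw [hp]
  simp only [Matrix.trace, Matrix.diag, Matrix.mul_apply, Fintype.sum_prod_type, Fintype.sum_bool,
    Matrix.of_apply, Matrix.kroneckerMap_apply, Matrix.kronecker, ketbra]
  cases s <;> simp [Matrix.single] <;> ring

theorem overlapOSP_eq (b s : Bool) (ρ : Matrix Bool Bool ℂ) :
    overlapOSP b s ρ = Real.sqrt (overlapSq b s ρ) := by
  rw [overlapOSP, trace_projOSP_mul, overlapSq]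

theorem overlapSq_smul (b s : Bool) (a : ℝ) (ρ : Matrix Bool Bool ℂ) :
    overlapSq b s ((a : ℂ) • ρ) = a * overlapSq b s ρ := by
  rw [overlapSq, overlapSq, ← Complex.re_ofReal_mul, Finset.mul_sum]
  congr 2
  funext c
  rw [Finset.mul_sum]
  refine Finset.sum_congr rfl fun c' _ => ?_
  simp only [Matrix.smul_apply, smul_eq_mul]
  ring

theorem norm_sq_targetVec_le (b s : Bool) (k : Bool → ℂ) :
    ‖∑ c, (targetVec b s c : ℂ) * k c‖ ^ 2 ≤ ∑ c, ‖k c‖ ^ 2 := by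
  simp only [Fintype.sum_bool]
  have h1 : ‖(targetVec b s true : ℂ) * k true + (targetVec b s false : ℂ) * k false‖ ≤
      |targetVec b s true| * ‖k true‖ + |targetVec b s false| * ‖k false‖ := by
    refine (norm_add_le _ _).trans (le_of_eq ?_)
    simp
  have h2 : |targetVec b s false| ^ 2 + |targetVec b s true| ^ 2 = 1 := by
    rw [sq_abs, sq_abs, targetVec_sq]
  have h3 := pow_le_pow_left₀ (norm_nonneg _) h1 2
  refine h3.trans ?_
  generalize |targetVec b s true| = p at *
  generalize |targetVec b s false| = q at *
  have hq : q ^ 2 = 1 - p ^ 2 := by linarith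
  -- Lagrange's identity: the square in the hint is the defect in Cauchy–Schwarz for the unit vector
  -- `(p, q)`.
  nlinarith [sq_nonneg (p * ‖k false‖ - q * ‖k true‖)]

theorem sum_targetVec_mul_star (b s : Bool) (k : Bool → ℂ) :
    ∑ c, ∑ c', (targetVec b s c : ℂ) * (targetVec b s c' : ℂ) * (k c * star (k c')) =
      ((‖∑ c, (targetVec b s c : ℂ) * k c‖ ^ 2 : ℝ) : ℂ) := by
  push_cast
  rw [← Complex.mul_conj', ← Complex.star_def, star_sum, Finset.sum_mul]
  refine Finset.sum_congr rfl fun c _ => ?_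
  rw [Finset.mul_sum]
  refine Finset.sum_congr rfl fun c' _ => ?_
  simp only [star_mul', Complex.star_def, Complex.conj_ofReal]
  ring

/-- For a mixture of unnormalized pure states the expectation of a rank-one projection is a sum of
squared inner products. Positivity and the bound by the trace follow from this form. -/
theorem overlapSq_sum_outer {β : Type} [Fintype β] (b s : Bool) (k : β → Bool → ℂ)
    (ρ : Matrix Bool Bool ℂ) (hρ : ∀ c c', ρ c c' = ∑ g, k g c * star (k g c')) :
    overlapSq b s ρ = ∑ g, ‖∑ c, (targetVec b s c : ℂ) * k g c‖ ^ 2 := by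
  have h : ∑ c, ∑ c', (targetVec b s c : ℂ) * (targetVec b s c' : ℂ) * ρ c c' =
      ∑ g, ∑ c, ∑ c', (targetVec b s c : ℂ) * (targetVec b s c' : ℂ) * (k g c * star (k g c')) := by
    simp only [hρ, Finset.mul_sum]
    rw [Finset.sum_comm]
    conv_rhs => rw [Finset.sum_comm]
    rw [Finset.sum_comm]
    exact Finset.sum_congr rfl fun c _ => Finset.sum_comm
  rw [overlapSq, h]
  simp only [sum_targetVec_mul_star]
  rw [← Complex.ofReal_sum, Complex.ofReal_re]

namespace TwoRoundProtocol

variable (P : TwoRoundProtocol) (lam : ℕ)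

theorem branchProb_eq (msgS : Bits (Fin (P.lenS lam))) (r : Bits (Fin (P.lenR lam))) :
    P.branchProb lam msgS r = ∑ c : Bool, (P.rcv lam).prob msgS (Sum.elim (fun _ => c) r) := by
  simp [branchProb, Matrix.trace, branch, QCirc.prob]

theorem sum_branchProb (msgS : Bits (Fin (P.lenS lam))) :
    ∑ r, P.branchProb lam msgS r = 1 := by
  rw [← (P.rcv lam).sum_prob msgS]
  simp only [branchProb_eq]
  rw [Finset.sum_comm, ← Fintype.sum_prod_type']
  refine Fintype.sum_equiv (((Equiv.funUnique Unit Bool).symm.prodCongr (Equiv.refl _)).trans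
    (Equiv.sumArrowEquivProdArrow Unit (Fin (P.lenR lam)) Bool).symm) _ _ fun p => ?_
  rfl

theorem overlapSq_branch_nonneg (msgS : Bits (Fin (P.lenS lam))) (r : Bits (Fin (P.lenR lam)))
    (b s : Bool) : 0 ≤ overlapSq b s (P.branch lam msgS r) := by
  rw [overlapSq_sum_outer b s
    (fun g c => (P.rcv lam).slice msgS g (Sum.elim (fun _ => c) r)) (P.branch lam msgS r)
    fun c c' => rfl]
  positivity

theorem overlapSq_branch_le (msgS : Bits (Fin (P.lenS lam))) (r : Bits (Fin (P.lenR lam)))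
    (b s : Bool) : overlapSq b s (P.branch lam msgS r) ≤ P.branchProb lam msgS r := by
  rw [overlapSq_sum_outer b s
    (fun g c => (P.rcv lam).slice msgS g (Sum.elim (fun _ => c) r)) (P.branch lam msgS r)
    fun c c' => rfl,
    branchProb_eq]
  simp only [QCirc.prob_eq]
  rw [Finset.sum_comm]
  exact Finset.sum_le_sum fun g _ => norm_sq_targetVec_le b s _

theorem branchProb_nonneg (msgS : Bits (Fin (P.lenS lam))) (r : Bits (Fin (P.lenR lam))) :
    0 ≤ P.branchProb lam msgS r :=
  (P.overlapSq_branch_nonneg lam msgS r false false).trans (P.overlapSq_branch_le lam msgS r _ _)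

theorem overlapOSP_branch (msgS : Bits (Fin (P.lenS lam))) (r : Bits (Fin (P.lenR lam)))
    (b s : Bool) :
    overlapOSP b s (((P.branchProb lam msgS r : ℂ))⁻¹ • P.branch lam msgS r) =
      Real.sqrt (overlapSq b s (P.branch lam msgS r) / P.branchProb lam msgS r) := by
  rw [overlapOSP_eq, ← Complex.ofReal_inv, overlapSq_smul, inv_mul_eq_div]

theorem overlapOSP_branch_le_one (msgS : Bits (Fin (P.lenS lam))) (r : Bits (Fin (P.lenR lam)))
    (b s : Bool) :
    overlapOSP b s (((P.branchProb lam msgS r : ℂ))⁻¹ • P.branch lam msgS r) ≤ 1 := by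
  rw [overlapOSP_branch, Real.sqrt_le_one]
  exact div_le_one_of_le₀ (P.overlapSq_branch_le lam msgS r b s) (P.branchProb_nonneg lam msgS r)

/-- On `[0, 1]` one has `t ≤ √t`, so the squared overlap may replace the overlap. -/
theorem overlapSq_branch_le_mul (msgS : Bits (Fin (P.lenS lam))) (r : Bits (Fin (P.lenR lam)))
    (b s : Bool) : overlapSq b s (P.branch lam msgS r) ≤ P.branchProb lam msgS r *
      overlapOSP b s (((P.branchProb lam msgS r : ℂ))⁻¹ • P.branch lam msgS r) := by
  have h0 := P.overlapSq_branch_nonneg lam msgS r b s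
  have h1 := P.overlapSq_branch_le lam msgS r b s
  have hp := P.branchProb_nonneg lam msgS r
  rw [overlapOSP_branch]
  rcases hp.eq_or_lt with hp | hp
  -- A message of probability 0 has a vanishing unnormalized overlap, so the value of the inverse at
  -- 0 is irrelevant.
  · rw [← hp, zero_mul]; linarith
  · set t := overlapSq b s (P.branch lam msgS r) / P.branchProb lam msgS r with ht
    have ht0 : 0 ≤ t := by positivity
    have ht1 : t ≤ 1 := div_le_one_of_le₀ h1 hp.le
    have hs : t ≤ Real.sqrt t := Real.le_sqrt_of_sq_le (by nlinarith)
    calc overlapSq b s (P.branch lam msgS r) = P.branchProb lam msgS r * t := by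
          rw [ht]; field_simp
      _ ≤ _ := by gcongr

theorem honestOverlap_le_one (b : Bool) : P.honestOverlap lam b ≤ 1 := by
  rw [honestOverlap, senExpect, ← (P.sen lam).expect_const (fun _ => b) 1]
  refine RCirc.expect_mono _ _ fun o => ?_
  rw [← P.sum_branchProb lam ((P.sen lam).eval (fun _ => b) o ∘ Sum.inl)]
  refine Finset.sum_le_sum fun r _ => ?_
  refine mul_le_of_le_one_right (P.branchProb_nonneg lam _ r) ?_
  rw [← (P.dec lam).expect_const (Sum.elim ((P.sen lam).eval (fun _ => b) o ∘ Sum.inr) r) 1]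
  exact RCirc.expect_mono _ _ fun s => P.overlapOSP_branch_le_one lam _ r b _

/-- Passing to squares removes both the square root and the normalization, leaving a quantity linear
in the receiver's state. -/
theorem le_honestOverlap (b : Bool) :
    (P.senExpect lam b fun msgS st => ∑ r, (P.dec lam).expect (Sum.elim st r) fun s =>
      overlapSq b (s ()) (P.branch lam msgS r)) ≤ P.honestOverlap lam b := by
  rw [honestOverlap, senExpect, senExpect]
  refine RCirc.expect_mono _ _ fun o => Finset.sum_le_sum fun r _ => ?_
  rw [← RCirc.expect_mul_left]
  exact RCirc.expect_mono _ _ fun s => P.overlapSq_branch_le_mul lam _ r b _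

end TwoRoundProtocol

/-! ### The measurement of the receiver -/

section Measurement

variable {lp n m : ℕ} (C : BCirc (Fin lp ⊕ (Unit ⊕ Fin n)) (Fin m)) (pp : Bits (Fin lp))

theorem norm_inv_sqrt_two_pow_sq (k : ℕ) : ‖((Real.sqrt 2 : ℂ) ^ k)⁻¹‖ ^ 2 = (2 ^ k)⁻¹ := by
  rw [norm_inv, norm_pow, Complex.norm_real, Real.norm_of_nonneg (Real.sqrt_nonneg _), inv_pow,
    ← pow_mul, mul_comm k 2, pow_mul, Real.sq_sqrt (by norm_num)]

/-- Completeness of the measurement: Parseval removes `d`, each pair `(c, x)` has exactly one image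
`y`, and the two values of `c` carry weight `1/2` each. -/
theorem sum_norm_sq_measMatrix (ψ : Bits (Fin n) → ℂ) :
    ∑ y, ∑ d, ∑ c, ‖(measMatrix C pp y d).mulVec ψ c‖ ^ 2 = ∑ x, ‖ψ x‖ ^ 2 := by
  have h : ∀ y d c, ‖(measMatrix C pp y d).mulVec ψ c‖ ^ 2 = (2 ^ (n + 1))⁻¹ *
      ‖∑ x, (DualModeFamily.phaseSign d x : ℂ) * ((if C.evalAt pp c x = y then 1 else 0) * ψ x)‖ ^ 2
      := by
    intro y d c
    rw [← norm_inv_sqrt_two_pow_sq, ← mul_pow, ← norm_mul, Finset.mul_sum]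
    congr 2
    refine Finset.sum_congr rfl fun x _ => ?_
    simp only [measMatrix, Matrix.of_apply]
    ring
  simp only [h]
  have h2 : ∀ y, ∑ d, ∑ c, (2 ^ (n + 1) : ℝ)⁻¹ * ‖∑ x, (DualModeFamily.phaseSign d x : ℂ) *
      ((if C.evalAt pp c x = y then 1 else 0) * ψ x)‖ ^ 2 =
      ∑ c, 2⁻¹ * ∑ x, if C.evalAt pp c x = y then ‖ψ x‖ ^ 2 else 0 := by
    intro y
    rw [Finset.sum_comm]
    refine Finset.sum_congr rfl fun c _ => ?_
    have h3 : (2 ^ (n + 1) : ℝ)⁻¹ * 2 ^ n = 2⁻¹ := by rw [pow_succ]; field_simp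
    rw [← Finset.mul_sum, sum_norm_sq_phaseSign, ← mul_assoc, h3]
    congr 1
    refine Finset.sum_congr rfl fun x _ => ?_
    split_ifs <;> simp
  simp only [h2]
  rw [Finset.sum_comm]
  simp only [← Finset.mul_sum]
  rw [Finset.sum_congr rfl fun c _ => Finset.sum_comm]
  simp

theorem overlapSq_sub (b s : Bool) (ρ σ : Matrix Bool Bool ℂ) :
    overlapSq b s (ρ - σ) = overlapSq b s ρ - overlapSq b s σ := by
  simp only [overlapSq, Matrix.sub_apply, mul_sub, Finset.sum_sub_distrib, Complex.sub_re]

/-- The probability of a correct guess after the measurement changes by at most the trace norm of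
the change of the state. -/
theorem sum_overlapSq_measMatrix_sub_le (b : Bool) (s : Bits (Fin m) → Bits (Fin n) → Bool)
    (ρ σ : Matrix (Bits (Fin n)) (Bits (Fin n)) ℂ) :
    ∑ y, ∑ d, overlapSq b (s y d)
        (measMatrix C pp y d * σ * (measMatrix C pp y d).conjTranspose) - traceNorm (ρ - σ) ≤
      ∑ y, ∑ d, overlapSq b (s y d)
        (measMatrix C pp y d * ρ * (measMatrix C pp y d).conjTranspose) := by
  -- Row `(y, d)` of `R` is the target vector applied to the measurement operator. Hence `R` is a
  -- contraction and the total score of a state `ρ` is `Tr (R ρ R†)`.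
  set R : Matrix (Bits (Fin m) × Bits (Fin n)) (Bits (Fin n)) ℂ := Matrix.of fun p x =>
    ∑ c, (targetVec b (s p.1 p.2) c : ℂ) * measMatrix C pp p.1 p.2 c x with hRdef
  have hRv : ∀ ψ p, R.mulVec ψ p =
      ∑ c, (targetVec b (s p.1 p.2) c : ℂ) * (measMatrix C pp p.1 p.2).mulVec ψ c := by
    intro ψ p
    simp only [Matrix.mulVec, dotProduct, hRdef, Matrix.of_apply, Finset.sum_mul, Finset.mul_sum]
    rw [Finset.sum_comm]
    simp only [mul_assoc]
  have hR : ∀ ψ : Bits (Fin n) → ℂ, ∑ k, ‖R.mulVec ψ k‖ ^ 2 ≤ ∑ x, ‖ψ x‖ ^ 2 := by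
    intro ψ
    rw [← sum_norm_sq_measMatrix C pp ψ, Fintype.sum_prod_type]
    refine Finset.sum_le_sum fun y _ => Finset.sum_le_sum fun d _ => ?_
    rw [hRv]
    exact norm_sq_targetVec_le _ _ _
  have htr : ∑ y, ∑ d, overlapSq b (s y d)
      (measMatrix C pp y d * (ρ - σ) * (measMatrix C pp y d).conjTranspose) =
      (R * (ρ - σ) * R.conjTranspose).trace.re := by
    rw [Matrix.trace, Fintype.sum_prod_type, Complex.re_sum]
    refine Finset.sum_congr rfl fun y _ => ?_
    rw [Complex.re_sum]
    refine Finset.sum_congr rfl fun d _ => ?_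
    rw [overlapSq]
    congr 1
    simp only [Matrix.diag_apply, Matrix.mul_apply, Matrix.conjTranspose_apply, hRdef,
      Matrix.of_apply, star_add, star_mul', Complex.star_def, Complex.conj_ofReal, Fintype.sum_bool,
      Finset.mul_sum, Finset.sum_mul, mul_add, add_mul, Finset.sum_add_distrib]
    simp only [mul_assoc, mul_left_comm, mul_comm]
  have hle := norm_trace_conj_le_traceNorm R hR (ρ - σ)
  have hre := (abs_le.mp ((Complex.abs_re_le_norm _).trans hle)).1
  rw [← htr] at hre
  simp only [Matrix.mul_sub, Matrix.sub_mul, overlapSq_sub, Finset.sum_sub_distrib] at hre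
  linarith

end Measurement

/-! ### Measuring the ideal state -/

namespace DualModeFamily

variable (T : DualModeFamily) (lam : ℕ) (pp : Bits (Fin (T.lenPP lam)))

theorem D_nonneg (x : Bits (Fin (T.n lam))) : 0 ≤ T.D lam pp x := (T.dist lam pp).2.1 x

theorem sum_D : ∑ x, T.D lam pp x = 1 := (T.dist lam pp).2.2

theorem F_eq (b : Bool) (x : Bits (Fin (T.n lam))) :
    T.F lam pp b x = (T.f lam).evalAt pp b x := rfl

theorem w_eq (y : Bits (Fin (T.m lam))) (d : Bits (Fin (T.n lam))) (b : Bool) :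
    T.w lam pp y d b =
      ∑ x, phaseSign d x * if T.F lam pp b x = y then Real.sqrt (T.D lam pp x) else 0 := by
  rw [w, Finset.sum_filter]
  refine Finset.sum_congr rfl fun x _ => ?_
  split_ifs <;> simp

/-- Parseval's identity for the amplitudes. -/
theorem sum_w_sq (y : Bits (Fin (T.m lam))) (b : Bool) :
    ∑ d, T.w lam pp y d b ^ 2 =
      2 ^ T.n lam * ∑ x, if T.F lam pp b x = y then T.D lam pp x else 0 := by
  have h := sum_norm_sq_phaseSign fun x =>
    ((if T.F lam pp b x = y then Real.sqrt (T.D lam pp x) else 0 : ℝ) : ℂ)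
  have h1 : ∀ d, ‖∑ x, (phaseSign d x : ℂ) *
      ((if T.F lam pp b x = y then Real.sqrt (T.D lam pp x) else 0 : ℝ) : ℂ)‖ ^ 2 =
      T.w lam pp y d b ^ 2 := fun d => by
    have hc : (∑ x, (phaseSign d x : ℂ) *
        ((if T.F lam pp b x = y then Real.sqrt (T.D lam pp x) else 0 : ℝ) : ℂ)) =
        (T.w lam pp y d b : ℂ) := by
      rw [w_eq, Complex.ofReal_sum]
      exact Finset.sum_congr rfl fun x _ => (Complex.ofReal_mul _ _).symm
    rw [hc, Complex.norm_real, Real.norm_eq_abs, sq_abs]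
  simp only [h1] at h
  rw [h]
  congr 1
  refine Finset.sum_congr rfl fun x _ => ?_
  split_ifs
  · rw [Complex.norm_real, Real.norm_of_nonneg (Real.sqrt_nonneg _),
      Real.sq_sqrt (T.D_nonneg lam pp x)]
  · simp

theorem sum_normSq (y : Bits (Fin (T.m lam))) :
    ∑ d, T.normSq lam pp y d =
      2 ^ T.n lam * ∑ b, ∑ x, if T.F lam pp b x = y then T.D lam pp x else 0 := by
  simp only [normSq, Finset.sum_add_distrib, sum_w_sq, Fintype.sum_bool]
  ring

theorem normSq_nonneg (y : Bits (Fin (T.m lam))) (d : Bits (Fin (T.n lam))) :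
    0 ≤ T.normSq lam pp y d := by
  unfold normSq; positivity

/-- Summing over all images. -/
theorem sum_image (g : Bits (Fin (T.m lam)) → ℝ) :
    ∑ y, (∑ b, ∑ x, if T.F lam pp b x = y then T.D lam pp x else 0) * g y =
      ∑ b, ∑ x, T.D lam pp x * g (T.F lam pp b x) := by
  simp only [Finset.sum_mul]
  rw [Finset.sum_comm]
  refine Finset.sum_congr rfl fun b _ => ?_
  rw [Finset.sum_comm]
  refine Finset.sum_congr rfl fun x _ => ?_
  simp [ite_mul]

/-- The ideal state is pure, so after the outcomes `y`, `d` the qubit is the vector `w` scaled by `2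
^ (-(n+1)/2)`. -/
theorem overlapSq_idealState (b s : Bool) (y : Bits (Fin (T.m lam)))
    (d : Bits (Fin (T.n lam))) :
    overlapSq b s (measMatrix (T.f lam) pp y d * T.idealState lam pp *
      (measMatrix (T.f lam) pp y d).conjTranspose) =
      (2 ^ (T.n lam + 1))⁻¹ * (∑ c, targetVec b s c * T.w lam pp y d c) ^ 2 := by
  have hk : ∀ c, ∑ x, measMatrix (T.f lam) pp y d c x * (Real.sqrt (T.D lam pp x) : ℂ) =
      ((Real.sqrt 2 : ℂ) ^ (T.n lam + 1))⁻¹ * (T.w lam pp y d c : ℂ) := fun c => by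
    rw [w_eq, Complex.ofReal_sum, Finset.mul_sum]
    refine Finset.sum_congr rfl fun x _ => ?_
    simp only [measMatrix, Matrix.of_apply, F_eq]
    by_cases hx : (T.f lam).evalAt pp c x = y
    · simp only [hx, if_true]
      push_cast
      ring
    · simp [hx]
  rw [overlapSq_sum_outer (β := Unit) b s
    (fun _ c => ((Real.sqrt 2 : ℂ) ^ (T.n lam + 1))⁻¹ * (T.w lam pp y d c : ℂ))]
  · rw [Fintype.sum_unique, ← norm_inv_sqrt_two_pow_sq, ← sq_abs (∑ c, _), ← mul_pow,
      ← Real.norm_eq_abs, ← Complex.norm_real, ← norm_mul]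
    push_cast
    rw [Finset.mul_sum]
    congr 2
    exact Finset.sum_congr rfl fun c _ => by ring
  · intro c c'
    rw [Fintype.sum_unique, ← hk, ← hk, Matrix.mul_apply]
    simp only [Matrix.mul_apply, Matrix.conjTranspose_apply, idealState, Matrix.of_apply, star_sum,
      star_mul', Finset.sum_mul, Finset.mul_sum, Complex.star_def, Complex.conj_ofReal]
    exact Finset.sum_congr rfl fun x _ => Finset.sum_congr rfl fun x' _ => by ring

theorem ind_nonneg (p : Prop) : 0 ≤ ind p := by
  unfold ind; split_ifs <;> norm_num

theorem ind_of {p : Prop} (h : p) : ind p = 1 := by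
  unfold ind; exact if_pos h

theorem ind_of_not {p : Prop} (h : ¬p) : ind p = 0 := by
  unfold ind; exact if_neg h

/-- Guessing the bit in disjoint mode. -/
theorem le_score_false (sp : Bits (Fin (T.lenSP lam))) :
    (∑ b : Bool, ((∑ x, T.D lam pp x *
      (T.partialInvert lam).expect (Sum.elim sp (T.F lam pp b x)) fun B =>
        ind (∀ b' : Bool, B b' = true ↔ ∃ x', T.F lam pp b' x' = T.F lam pp b x)) -
      ∑ x, T.D lam pp x * ind (∃ x', T.F lam pp (!b) x' = T.F lam pp b x))) / 2 ≤
    ∑ y, ∑ d, (T.partialInvert lam).expect (Sum.elim sp y) fun B =>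
      overlapSq false (B true) (measMatrix (T.f lam) pp y d * T.idealState lam pp *
        (measMatrix (T.f lam) pp y d).conjTranspose) := by
  -- The decoder does not look at `d`. Summing over `d`, Parseval makes the score the probability of
  -- `B true = b` for a uniform `b` and `x ← D`.
  have h1 : ∀ y, (∑ d, (T.partialInvert lam).expect (Sum.elim sp y) fun B =>
      overlapSq false (B true) (measMatrix (T.f lam) pp y d * T.idealState lam pp *
        (measMatrix (T.f lam) pp y d).conjTranspose)) =
      ∑ b, ∑ x, 2⁻¹ * if T.F lam pp b x = y then T.D lam pp x *
        (T.partialInvert lam).expect (Sum.elim sp y) fun B => ind (B true = b) else 0 := by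
    intro y
    rw [← RCirc.expect_sum]
    have h2 : ∀ B : Bits Bool, (∑ d, overlapSq false (B true) (measMatrix (T.f lam) pp y d *
        T.idealState lam pp * (measMatrix (T.f lam) pp y d).conjTranspose)) =
        ∑ b, ∑ x, (2⁻¹ * if T.F lam pp b x = y then T.D lam pp x else 0) * ind (B true = b) := by
      intro B
      have h3 : (2 ^ (T.n lam + 1) : ℝ)⁻¹ * 2 ^ T.n lam = 2⁻¹ := by rw [pow_succ]; field_simp
      simp only [overlapSq_idealState, ← Finset.mul_sum, ← Finset.sum_mul]
      cases B true <;> simp [targetVec, sum_w_sq, ← mul_assoc, h3, ind]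
    simp only [h2]
    rw [RCirc.expect_sum]
    refine Finset.sum_congr rfl fun b _ => ?_
    rw [RCirc.expect_sum]
    refine Finset.sum_congr rfl fun x _ => ?_
    rw [RCirc.expect_mul_left, mul_assoc, ite_mul, zero_mul]
  simp only [h1]
  rw [Finset.sum_comm, Finset.sum_div]
  refine Finset.sum_le_sum fun b _ => ?_
  rw [Finset.sum_comm, ← Finset.sum_sub_distrib, Finset.sum_div]
  refine Finset.sum_le_sum fun x _ => ?_
  rw [← Finset.mul_sum, Finset.sum_ite_eq, if_pos (Finset.mem_univ _), ← mul_sub, div_eq_inv_mul]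
  have hD := T.D_nonneg lam pp x
  gcongr
  rw [← RCirc.expect_const (T.partialInvert lam) (Sum.elim sp (T.F lam pp b x))
    (ind (∃ x', T.F lam pp (!b) x' = T.F lam pp b x)), ← RCirc.expect_sub]
  refine RCirc.expect_mono _ _ fun r => ?_
  generalize (T.partialInvert lam).eval (Sum.elim sp (T.F lam pp b x)) r = B
  -- A collision makes the left side nonpositive. Otherwise correct inversion returns the set `{b}`,
  -- whose indicator at `true` is `b`.
  by_cases hx : ∃ x', T.F lam pp (!b) x' = T.F lam pp b x
  · rw [ind_of hx]
    have := ind_nonneg (B true = b)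
    have : ind (∀ b' : Bool, B b' = true ↔ ∃ x', T.F lam pp b' x' = T.F lam pp b x) ≤ 1 := by
      unfold ind; split_ifs <;> norm_num
    linarith
  · rw [ind_of_not hx, sub_zero]
    by_cases hB : ∀ b' : Bool, B b' = true ↔ ∃ x', T.F lam pp b' x' = T.F lam pp b x
    · rw [ind_of hB, ind_of]
      cases b
      · exact Bool.eq_false_iff.mpr fun h => hx ((hB true).mp h)
      · exact (hB true).mpr ⟨x, rfl⟩
    · rw [ind_of_not hB]; exact ind_nonneg _

/-- The overlap with `H|s⟩` is governed by the sum of the signed amplitudes. By the parallelogram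
identity it misses the full weight by half the squared difference, at most `normSq * ν² / 2` when
the guess is good. -/
theorem overlapSq_true_ge (y : Bits (Fin (T.m lam))) (d : Bits (Fin (T.n lam))) (s : Bool)
    (ν : ℝ) :
    (2 ^ (T.n lam + 1))⁻¹ * T.normSq lam pp y d * ind (|T.wTilde lam pp y d false -
      (if s then -1 else 1) * T.wTilde lam pp y d true| ≤ ν) -
      (2 ^ (T.n lam + 1))⁻¹ * T.normSq lam pp y d * (ν ^ 2 / 2) ≤
    overlapSq true s (measMatrix (T.f lam) pp y d * T.idealState lam pp *
      (measMatrix (T.f lam) pp y d).conjTranspose) := by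
  rw [overlapSq_idealState, mul_assoc, mul_assoc, ← mul_sub]
  have hN := T.normSq_nonneg lam pp y d
  refine mul_le_mul_of_nonneg_left ?_ (by positivity)
  have hv : (∑ c, targetVec true s c * T.w lam pp y d c) ^ 2 =
      (T.w lam pp y d false + (if s then -1 else 1) * T.w lam pp y d true) ^ 2 / 2 := by
    have h2 : (Real.sqrt 2) ^ 2 = 2 := Real.sq_sqrt (by norm_num)
    rw [← h2, ← div_pow]
    congr 1
    cases s <;> simp [targetVec] <;> ring
  rw [hv]
  by_cases hg : |T.wTilde lam pp y d false -
      (if s then -1 else 1) * T.wTilde lam pp y d true| ≤ ν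
  · rw [ind_of hg]
    rcases hN.eq_or_lt with h0 | h0
    · rw [← h0]; simp; positivity
    · have hs : Real.sqrt (T.normSq lam pp y d) ^ 2 = T.normSq lam pp y d := Real.sq_sqrt hN
      have hsp : Real.sqrt (T.normSq lam pp y d) ≠ 0 := (Real.sqrt_pos.mpr h0).ne'
      have hw : ∀ c, T.w lam pp y d c =
          T.wTilde lam pp y d c * Real.sqrt (T.normSq lam pp y d) := fun c => by
        rw [wTilde]; field_simp
      have hd : (T.w lam pp y d false - (if s then -1 else 1) * T.w lam pp y d true) ^ 2 ≤
          T.normSq lam pp y d * ν ^ 2 := by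
        rw [hw, hw, ← mul_assoc, ← sub_mul, mul_pow, hs, mul_comm]
        exact mul_le_mul_of_nonneg_left (sq_le_sq' (abs_le.mp hg).1 (abs_le.mp hg).2) hN
      have hsum : (T.w lam pp y d false - (if s then -1 else 1) * T.w lam pp y d true) ^ 2 +
          (T.w lam pp y d false + (if s then -1 else 1) * T.w lam pp y d true) ^ 2 =
          2 * T.normSq lam pp y d := by
        rw [normSq]; cases s <;> simp <;> ring
      linarith
  · rw [ind_of_not hg]
    have : 0 ≤ T.normSq lam pp y d * (ν ^ 2 / 2) := by positivity
    have : 0 ≤ (T.w lam pp y d false + (if s then -1 else 1) * T.w lam pp y d true) ^ 2 / 2 := by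
      positivity
    linarith

/-- Guessing the phase in lossy mode. -/
theorem le_score_true (sp : Bits (Fin (T.lenSP lam))) (ν : ℝ) :
    (∑ b : Bool, ∑ x, T.D lam pp x * ∑ d, T.phaseProb lam pp (T.F lam pp b x) d *
        (T.phaseInvert lam).expect (Sum.elim sp (Sum.elim (T.F lam pp b x) d)) fun s =>
          ind (|T.wTilde lam pp (T.F lam pp b x) d false -
            (if s () then -1 else 1) * T.wTilde lam pp (T.F lam pp b x) d true| ≤ ν)) / 2 -
      ν ^ 2 / 2 ≤
    ∑ y, ∑ d, (T.phaseInvert lam).expect (Sum.elim sp (Sum.elim y d)) fun s =>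
      overlapSq true (s ()) (measMatrix (T.f lam) pp y d * T.idealState lam pp *
        (measMatrix (T.f lam) pp y d).conjTranspose) := by
  set E : Bits (Fin (T.m lam)) → Bits (Fin (T.n lam)) → ℝ := fun y d =>
    (T.phaseInvert lam).expect (Sum.elim sp (Sum.elim y d)) fun s =>
      ind (|T.wTilde lam pp y d false -
        (if s () then -1 else 1) * T.wTilde lam pp y d true| ≤ ν) with hE
  have h3 : (2 ^ (T.n lam + 1) : ℝ)⁻¹ * 2 ^ T.n lam = 2⁻¹ := by rw [pow_succ]; field_simp
  have htot : ∑ y, ∑ d, (2 ^ (T.n lam + 1) : ℝ)⁻¹ * T.normSq lam pp y d = 1 := by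
    have := T.sum_image lam pp fun _ => 1
    simp only [mul_one, sum_D] at this
    simp only [← Finset.mul_sum, sum_normSq, this, ← mul_assoc, h3]
    simp
  -- The weight of `y` is half of `2 ^ (-n) * ∑ d, normSq`; this cancels the denominator of
  -- `phaseProb`, so `(y, d)` has joint probability `2 ^ (-(n+1)) * normSq`.
  have hprob : (∑ b : Bool, ∑ x, T.D lam pp x * ∑ d, T.phaseProb lam pp (T.F lam pp b x) d *
      E (T.F lam pp b x) d) / 2 =
      ∑ y, ∑ d, (2 ^ (T.n lam + 1) : ℝ)⁻¹ * T.normSq lam pp y d * E y d := by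
    rw [← T.sum_image lam pp fun y => ∑ d, T.phaseProb lam pp y d * E y d, Finset.sum_div]
    refine Finset.sum_congr rfl fun y _ => ?_
    have hS : ∑ b, ∑ x, (if T.F lam pp b x = y then T.D lam pp x else 0) =
        (2 ^ T.n lam)⁻¹ * ∑ d, T.normSq lam pp y d := by
      rw [sum_normSq]; field_simp
    rw [hS, Finset.mul_sum, Finset.sum_div]
    refine Finset.sum_congr rfl fun d _ => ?_
    rw [phaseProb]
    -- For a `y` outside the support the division by 0 is harmless, since each `normSq` vanishes
    -- too.
    by_cases h0 : ∑ d, T.normSq lam pp y d = 0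
    · have := (Finset.sum_eq_zero_iff_of_nonneg fun d _ => T.normSq_nonneg lam pp y d).mp h0 d
        (Finset.mem_univ d)
      rw [this]; simp
    · rw [pow_succ]; field_simp
  change (∑ b : Bool, ∑ x, T.D lam pp x * ∑ d, T.phaseProb lam pp (T.F lam pp b x) d *
      E (T.F lam pp b x) d) / 2 - ν ^ 2 / 2 ≤ _
  rw [hprob]
  have hν : ν ^ 2 / 2 = ∑ y, ∑ d, (2 ^ (T.n lam + 1) : ℝ)⁻¹ * T.normSq lam pp y d * (ν ^ 2 / 2) := by
    simp only [← Finset.sum_mul, htot, one_mul]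
  rw [hν]
  simp only [← Finset.sum_sub_distrib]
  refine Finset.sum_le_sum fun y _ => Finset.sum_le_sum fun d _ => ?_
  rw [hE]
  beta_reduce
  rw [← RCirc.expect_mul_left, ← RCirc.expect_const (T.phaseInvert lam)
    (Sum.elim sp (Sum.elim y d)) ((2 ^ (T.n lam + 1) : ℝ)⁻¹ * T.normSq lam pp y d * (ν ^ 2 / 2)),
    ← RCirc.expect_sub]
  exact RCirc.expect_mono _ _ fun r => T.overlapSq_true_ge lam pp y d _ ν

/-! ### The protocol -/

/-- The sender: generate parameters in mode `b`, send `pp` and keep `sp` and `b`. -/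
def senCirc : RCirc Unit (Fin (T.lenPP lam) ⊕ Fin (T.lenSP lam + 1)) where
  coins := (T.gen lam).coins
  circ :=
    { gates := (T.gen lam).circ.gates
      out := Sum.elim (fun i => (T.gen lam).circ.out (Sum.inl i))
        (Fin.snoc (α := fun _ => (Unit ⊕ Fin (T.gen lam).coins) ⊕ ℕ)
          (fun i => (T.gen lam).circ.out (Sum.inr i)) (Sum.inl (Sum.inl ()))) }

theorem senCirc_eval (b : Bool) (r : Bits (Fin (T.gen lam).coins)) :
    (T.senCirc lam).eval (fun _ => b) r =
      Sum.elim ((T.gen lam).eval (fun _ => b) r ∘ Sum.inl)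
        (Fin.snoc (α := fun _ => Bool) ((T.gen lam).eval (fun _ => b) r ∘ Sum.inr) b) := by
  funext k
  rcases k with k | k
  · rfl
  · refine Fin.lastCases ?_ (fun i => ?_) k
    · simp [senCirc, RCirc.eval, BCirc.eval, wireValue]
    · simp only [senCirc, RCirc.eval, BCirc.eval, Sum.elim_inr, Fin.snoc_castSucc,
        Function.comp_apply]
      rfl

/-- The decoder: partial inversion in disjoint mode, phase computation in lossy mode. -/
def decCirc : RCirc (Fin (T.lenSP lam + 1) ⊕ Fin (T.m lam + T.n lam)) Unit where
  coins := (T.partialInvert lam).coins + (T.phaseInvert lam).coins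
  circ := muxCirc (Sum.inl (Sum.inl (Fin.last _)))
    (T.partialInvert lam).circ
    (Sum.elim (Sum.elim (fun i => Sum.inl (Sum.inl i.castSucc))
      (fun i => Sum.inl (Sum.inr (Fin.castAdd _ i)))) (fun i => Sum.inr (Fin.castAdd _ i))) true
    (T.phaseInvert lam).circ
    (Sum.elim (Sum.elim (fun i => Sum.inl (Sum.inl i.castSucc))
      (Sum.elim (fun i => Sum.inl (Sum.inr (Fin.castAdd _ i)))
        (fun i => Sum.inl (Sum.inr (Fin.natAdd _ i))))) (fun i => Sum.inr (Fin.natAdd _ i))) ()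

theorem decCirc_eval (sp : Bits (Fin (T.lenSP lam))) (b : Bool) (y : Bits (Fin (T.m lam)))
    (d : Bits (Fin (T.n lam))) (r₁ : Bits (Fin (T.partialInvert lam).coins))
    (r₂ : Bits (Fin (T.phaseInvert lam).coins)) :
    (T.decCirc lam).eval (Sum.elim (Fin.snoc (α := fun _ => Bool) sp b) (Fin.append y d))
      (Fin.append r₁ r₂) = fun _ =>
        if b then (T.phaseInvert lam).eval (Sum.elim sp (Sum.elim y d)) r₂ ()
        else (T.partialInvert lam).eval (Sum.elim sp y) r₁ true := by
  refine (muxCirc_eval _ _ _ _ _ _ _ _).trans ?_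
  funext u
  have h1 : (Sum.elim (Sum.elim (Fin.snoc (α := fun _ => Bool) sp b) (Fin.append y d))
      (Fin.append r₁ r₂)) ∘ (Sum.elim (Sum.elim (fun i => Sum.inl (Sum.inl i.castSucc))
      (Sum.elim (fun i => Sum.inl (Sum.inr (Fin.castAdd _ i)))
        (fun i => Sum.inl (Sum.inr (Fin.natAdd _ i))))) (fun i => Sum.inr (Fin.natAdd _ i))) =
      Sum.elim (Sum.elim sp (Sum.elim y d)) r₂ := by
    funext w; rcases w with (w | w | w) | w <;> simp
  have h2 : (Sum.elim (Sum.elim (Fin.snoc (α := fun _ => Bool) sp b) (Fin.append y d))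
      (Fin.append r₁ r₂)) ∘ (Sum.elim (Sum.elim (fun i => Sum.inl (Sum.inl i.castSucc))
      (fun i => Sum.inl (Sum.inr (Fin.castAdd _ i)))) (fun i => Sum.inr (Fin.castAdd _ i))) =
      Sum.elim (Sum.elim sp y) r₁ := by
    funext w; rcases w with (w | w) | w <;> simp
  have h3 := Fin.snoc_last (α := fun _ => Bool) b sp
  cases b
  · exact (if_neg (Bool.eq_false_iff.mp h3)).trans (congrFun (congrArg (T.partialInvert lam).circ.eval h2) true)
  · exact (if_pos h3).trans (congrFun (congrArg (T.phaseInvert lam).circ.eval h1) ())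

/-- The decoder has coins for both inverters; those of the inverter not selected average out. -/
theorem decCirc_expect (sp : Bits (Fin (T.lenSP lam))) (b : Bool) (y : Bits (Fin (T.m lam)))
    (d : Bits (Fin (T.n lam))) (g : Bool → ℝ) :
    ((T.decCirc lam).expect (Sum.elim (Fin.snoc (α := fun _ => Bool) sp b) (Fin.append y d))
      fun s => g (s ())) =
      if b then (T.phaseInvert lam).expect (Sum.elim sp (Sum.elim y d)) fun s => g (s ())
      else (T.partialInvert lam).expect (Sum.elim sp y) fun B => g (B true) := by
  have h : ∑ r, g ((T.decCirc lam).eval (Sum.elim (Fin.snoc (α := fun _ => Bool) sp b)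
      (Fin.append y d)) r ()) = ∑ r₁ : Bits (Fin (T.partialInvert lam).coins),
        ∑ r₂ : Bits (Fin (T.phaseInvert lam).coins),
        g (if b then (T.phaseInvert lam).eval (Sum.elim sp (Sum.elim y d)) r₂ ()
        else (T.partialInvert lam).eval (Sum.elim sp y) r₁ true) := by
    rw [← Fintype.sum_prod_type']
    symm
    refine Fintype.sum_equiv (Fin.appendEquiv _ _) _ _ fun p => ?_
    exact congrArg g (congrFun (T.decCirc_eval lam sp b y d p.1 p.2) ()).symm
  rw [RCirc.expect, h]
  have hc : (2 : ℝ) ^ (T.decCirc lam).coins =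
      2 ^ (T.partialInvert lam).coins * 2 ^ (T.phaseInvert lam).coins := pow_add _ _ _
  rw [hc]
  cases b
  · simp only [RCirc.expect, Bool.false_eq_true, if_false, Finset.sum_const, Finset.card_univ,
      Fintype.card_fun, Fintype.card_fin, Fintype.card_bool, nsmul_eq_mul, ← Finset.mul_sum]
    push_cast
    field_simp
  · simp [RCirc.expect]
    field_simp

end DualModeFamily

namespace DualModeFamily

variable (T : DualModeFamily)

theorem polyBounded_senCirc : PolyBounded fun lam => (T.senCirc lam).size := by
  refine (T.gen_ppt.add (PolyBounded.const 1)).mono fun lam => ?_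
  change Fintype.card (Unit ⊕ Fin (T.gen lam).coins) + (T.gen lam).circ.gates.length +
    Fintype.card (Fin (T.lenPP lam) ⊕ Fin (T.lenSP lam + 1)) ≤ _
  simp only [RCirc.size, BCirc.size, Fintype.card_sum, Fintype.card_fin]
  omega

theorem polyBounded_decCirc : PolyBounded fun lam => (T.decCirc lam).size := by
  refine ((T.partialInvert_ppt.add T.phaseInvert_ppt).add (PolyBounded.const 6)).mono fun lam => ?_
  change Fintype.card ((Fin (T.lenSP lam + 1) ⊕ Fin (T.m lam + T.n lam)) ⊕
    Fin ((T.partialInvert lam).coins + (T.phaseInvert lam).coins)) +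
    (T.decCirc lam).circ.gates.length + Fintype.card Unit ≤ _
  simp only [RCirc.size, BCirc.size, decCirc, muxCirc, Fintype.card_sum, Fintype.card_fin,
    Fintype.card_unit, Fintype.card_bool, List.length_append, List.length_map, List.length_cons,
    List.length_nil]
  omega

variable (Prep : ∀ lam, QCirc (Fin (T.lenPP lam)) (Fin (T.n lam)))

theorem polyBounded_rcvCirc (hPrep : PolyBounded fun lam => (Prep lam).size) :
    PolyBounded fun lam => (rcvCirc (Prep lam) (T.f lam)).size := by
  have hf2 := T.f_ppt.add T.f_ppt
  have hf4 := hf2.add hf2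
  refine (((hPrep.add hPrep).add (hf4.add (hf2.add T.f_ppt))).add (PolyBounded.const 4)).mono
    fun lam => ?_
  have := rcvCirc_size (Prep lam) (T.f lam)
  omega

/-- The two-round protocol: the receiver measures the image `y` and then the string `x` in the
Hadamard basis, and the sender decodes with the trapdoor. -/
noncomputable def protocol (hPrep : PolyBounded fun lam => (Prep lam).size) :
    TwoRoundProtocol where
  lenS := T.lenPP
  lenSt lam := T.lenSP lam + 1
  lenR lam := T.m lam + T.n lam
  sen := T.senCirc
  rcv lam := rcvCirc (Prep lam) (T.f lam)
  dec := T.decCirc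
  sen_ppt := T.polyBounded_senCirc
  rcv_qpt := T.polyBounded_rcvCirc Prep hPrep
  dec_ppt := T.polyBounded_decCirc

variable {Prep} (hPrep : PolyBounded fun lam => (Prep lam).size)

/-! ### Analysis of an honest execution -/

theorem senExpect_protocol (lam : ℕ) (b : Bool)
    (g : Bits (Fin (T.lenPP lam)) → Bits (Fin (T.lenSP lam + 1)) → ℝ) :
    (T.protocol Prep hPrep).senExpect lam b g =
      T.genExpect lam b fun pp sp => g pp (Fin.snoc (α := fun _ => Bool) sp b) := by
  change (∑ r : Bits (Fin (T.gen lam).coins), g ((T.senCirc lam).eval (fun _ => b) r ∘ Sum.inl)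
    ((T.senCirc lam).eval (fun _ => b) r ∘ Sum.inr)) / 2 ^ (T.gen lam).coins = _
  rw [genExpect, RCirc.expect]
  congr 1
  refine Finset.sum_congr rfl fun r _ => ?_
  have h := T.senCirc_eval lam b r
  rw [h]
  rfl

theorem branch_protocol (lam : ℕ) (pp : Bits (Fin (T.lenPP lam))) (y : Bits (Fin (T.m lam)))
    (d : Bits (Fin (T.n lam))) :
    (T.protocol Prep hPrep).branch lam pp (Fin.append y d) =
      measMatrix (T.f lam) pp y d * (Prep lam).density pp *
        (measMatrix (T.f lam) pp y d).conjTranspose := by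
  ext i j
  exact rcvCirc_density (Prep lam) (T.f lam) pp y d i j

/-- The expected squared overlap when the receiver starts from the state `ρ`. -/
noncomputable def score (lam : ℕ) (b : Bool) (pp : Bits (Fin (T.lenPP lam)))
    (sp : Bits (Fin (T.lenSP lam)))
    (ρ : Matrix (Bits (Fin (T.n lam))) (Bits (Fin (T.n lam))) ℂ) : ℝ :=
  ∑ y, ∑ d, (T.decCirc lam).expect
    (Sum.elim (Fin.snoc (α := fun _ => Bool) sp b) (Fin.append y d)) fun s =>
      overlapSq b (s ()) (measMatrix (T.f lam) pp y d * ρ *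
        (measMatrix (T.f lam) pp y d).conjTranspose)

/-- For fixed coins the decoder is a deterministic guess from `(y, d)`, to which the contraction
bound applies; then average over the coins. -/
theorem score_sub_le (lam : ℕ) (b : Bool) (pp : Bits (Fin (T.lenPP lam)))
    (sp : Bits (Fin (T.lenSP lam)))
    (ρ σ : Matrix (Bits (Fin (T.n lam))) (Bits (Fin (T.n lam))) ℂ) :
    T.score lam b pp sp σ - traceNorm (ρ - σ) ≤ T.score lam b pp sp ρ := by
  have h : ∀ τ, T.score lam b pp sp τ = (∑ r, ∑ y, ∑ d, overlapSq b ((T.decCirc lam).eval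
      (Sum.elim (Fin.snoc (α := fun _ => Bool) sp b) (Fin.append y d)) r ())
      (measMatrix (T.f lam) pp y d * τ * (measMatrix (T.f lam) pp y d).conjTranspose)) /
      2 ^ (T.decCirc lam).coins := fun τ => by
    simp only [score, RCirc.expect, ← Finset.sum_div]
    congr 1
    rw [Finset.sum_comm]
    rw [Finset.sum_congr rfl fun y _ => Finset.sum_comm]
    rw [Finset.sum_comm]
    rw [Finset.sum_congr rfl fun y _ => Finset.sum_comm]
  have ht : traceNorm (ρ - σ) = (∑ r : Bits (Fin (T.decCirc lam).coins), traceNorm (ρ - σ)) /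
      2 ^ (T.decCirc lam).coins := by simp
  rw [h, h, ht, ← sub_div, ← Finset.sum_sub_distrib]
  gcongr with r
  exact sum_overlapSq_measMatrix_sub_le (T.f lam) pp b (fun y d => (T.decCirc lam).eval
      (Sum.elim (Fin.snoc (α := fun _ => Bool) sp b) (Fin.append y d)) r ()) ρ σ

/-- The factor 2 undoes the half in the trace distance. The bound on the preparation is needed only
for parameters that `gen` can output. -/
theorem le_honestOverlap_protocol (lam : ℕ) (b : Bool) (ε : ℝ)
    (hε : ∀ pp, T.IsParam lam b pp →
      traceDist ((Prep lam).density pp) (T.idealState lam pp) ≤ ε) :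
    (T.genExpect lam b fun pp sp => T.score lam b pp sp (T.idealState lam pp)) - 2 * ε ≤
      (T.protocol Prep hPrep).honestOverlap lam b := by
  refine le_trans ?_ ((T.protocol Prep hPrep).le_honestOverlap lam b)
  refine le_trans ?_ (T.senExpect_protocol hPrep lam b _).ge
  rw [genExpect, genExpect,
    ← RCirc.expect_const (T.gen lam) (fun _ => b) (2 * ε), ← RCirc.expect_sub]
  refine RCirc.expect_mono _ _ fun r => ?_
  set pp := (T.gen lam).eval (fun _ => b) r ∘ Sum.inl
  set sp := (T.gen lam).eval (fun _ => b) r ∘ Sum.inr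
  have h1 := hε pp ⟨r, rfl⟩
  rw [traceDist] at h1
  have h2 := T.score_sub_le lam b pp sp ((Prep lam).density pp) (T.idealState lam pp)
  have h3 : T.score lam b pp sp ((Prep lam).density pp) =
      ∑ q : Bits (Fin (T.m lam + T.n lam)), (T.decCirc lam).expect
        (Sum.elim (Fin.snoc (α := fun _ => Bool) sp b) q) fun s =>
        overlapSq b (s ()) ((T.protocol Prep hPrep).branch lam pp q) := by
    rw [score, ← Fintype.sum_prod_type']
    refine Fintype.sum_equiv (Fin.appendEquiv _ _) _ _ fun p => ?_
    simp only [← T.branch_protocol hPrep]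
    rfl
  change _ ≤ ∑ q : Bits (Fin (T.m lam + T.n lam)), (T.decCirc lam).expect
        (Sum.elim (Fin.snoc (α := fun _ => Bool) sp b) q) fun s =>
        overlapSq b (s ()) ((T.protocol Prep hPrep).branch lam pp q)
  rw [← h3]
  linarith

/-! ### Correctness and security -/

variable {T}

theorem correct_false (hT : T.IsPhaseDTCF) {ε : ℕ → ℝ} (hε : Negligible ε)
    (hP : ∀ lam μ pp, T.IsParam lam μ pp →
      traceDist ((Prep lam).density pp) (T.idealState lam pp) ≤ ε lam) :
    Negligible fun lam => 1 - (T.protocol Prep hPrep).honestOverlap lam false := by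
  -- By the score bound the inversion and collision errors enter with weight `1/2` and the
  -- preparation error twice; the sum of absolute values dominates this.
  refine Negligible.of_abs_le ((((hT.partialInversion false false).abs.add
    (hT.partialInversion false true).abs).add ((hT.disjoint false).abs.add
    (hT.disjoint true).abs)).add (hε.abs.add hε.abs)) fun lam => ?_
  rw [abs_of_nonneg (sub_nonneg.mpr ((T.protocol Prep hPrep).honestOverlap_le_one lam false))]
  refine le_trans ?_ (le_abs_self _)
  have h := T.le_honestOverlap_protocol hPrep lam false (ε lam) (hP lam false)
  have hs : (T.genExpect lam false fun pp sp =>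
      (∑ b : Bool, ((∑ x, T.D lam pp x *
        (T.partialInvert lam).expect (Sum.elim sp (T.F lam pp b x)) fun B =>
          ind (∀ b' : Bool, B b' = true ↔ ∃ x', T.F lam pp b' x' = T.F lam pp b x)) -
        ∑ x, T.D lam pp x * ind (∃ x', T.F lam pp (!b) x' = T.F lam pp b x))) / 2) ≤
      T.genExpect lam false fun pp sp => T.score lam false pp sp (T.idealState lam pp) := by
    refine RCirc.expect_mono _ _ fun r => ?_
    refine (T.le_score_false lam _ _).trans (le_of_eq ?_)
    beta_reduce
    rw [score]
    refine Finset.sum_congr rfl fun y _ => Finset.sum_congr rfl fun d _ => ?_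
    rw [decCirc_expect _ _ _ _ _ _ fun s => overlapSq false s _]
    simp
  have hlin : (T.genExpect lam false fun pp sp =>
      (∑ b : Bool, ((∑ x, T.D lam pp x *
        (T.partialInvert lam).expect (Sum.elim sp (T.F lam pp b x)) fun B =>
          ind (∀ b' : Bool, B b' = true ↔ ∃ x', T.F lam pp b' x' = T.F lam pp b x)) -
        ∑ x, T.D lam pp x * ind (∃ x', T.F lam pp (!b) x' = T.F lam pp b x))) / 2) =
      (∑ b : Bool, ((T.genExpect lam false fun pp sp => ∑ x, T.D lam pp x *
        (T.partialInvert lam).expect (Sum.elim sp (T.F lam pp b x)) fun B =>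
          ind (∀ b' : Bool, B b' = true ↔ ∃ x', T.F lam pp b' x' = T.F lam pp b x)) -
        T.genExpect lam false fun pp _ =>
          ∑ x, T.D lam pp x * ind (∃ x', T.F lam pp (!b) x' = T.F lam pp b x))) / 2 := by
    simp only [genExpect, div_eq_inv_mul (_ : ℝ) 2]
    rw [RCirc.expect_mul_left, RCirc.expect_sum]
    simp only [RCirc.expect_sub]
  rw [hlin, Fintype.sum_bool] at hs
  have e1 := le_abs_self (1 - T.genExpect lam false fun pp sp => ∑ x, T.D lam pp x *
        (T.partialInvert lam).expect (Sum.elim sp (T.F lam pp false x)) fun B =>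
          ind (∀ b' : Bool, B b' = true ↔ ∃ x', T.F lam pp b' x' = T.F lam pp false x))
  have e2 := le_abs_self (1 - T.genExpect lam false fun pp sp => ∑ x, T.D lam pp x *
        (T.partialInvert lam).expect (Sum.elim sp (T.F lam pp true x)) fun B =>
          ind (∀ b' : Bool, B b' = true ↔ ∃ x', T.F lam pp b' x' = T.F lam pp true x))
  have e3 := le_abs_self (T.genExpect lam false fun pp _ =>
          ∑ x, T.D lam pp x * ind (∃ x', T.F lam pp (!false) x' = T.F lam pp false x))
  have e4 := le_abs_self (T.genExpect lam false fun pp _ =>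
          ∑ x, T.D lam pp x * ind (∃ x', T.F lam pp (!true) x' = T.F lam pp true x))
  have e5 := le_abs_self (ε lam)
  have a1 := abs_nonneg (1 - T.genExpect lam false fun pp sp => ∑ x, T.D lam pp x *
        (T.partialInvert lam).expect (Sum.elim sp (T.F lam pp false x)) fun B =>
          ind (∀ b' : Bool, B b' = true ↔ ∃ x', T.F lam pp b' x' = T.F lam pp false x))
  have a2 := abs_nonneg (1 - T.genExpect lam false fun pp sp => ∑ x, T.D lam pp x *
        (T.partialInvert lam).expect (Sum.elim sp (T.F lam pp true x)) fun B =>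
          ind (∀ b' : Bool, B b' = true ↔ ∃ x', T.F lam pp b' x' = T.F lam pp true x))
  have a3 := abs_nonneg (T.genExpect lam false fun pp _ =>
          ∑ x, T.D lam pp x * ind (∃ x', T.F lam pp (!false) x' = T.F lam pp false x))
  have a4 := abs_nonneg (T.genExpect lam false fun pp _ =>
          ∑ x, T.D lam pp x * ind (∃ x', T.F lam pp (!true) x' = T.F lam pp true x))
  linarith

theorem correct_true (hT : T.IsPhaseDTCF) {ε : ℕ → ℝ} (hε : Negligible ε)
    (hP : ∀ lam μ pp, T.IsParam lam μ pp →
      traceDist ((Prep lam).density pp) (T.idealState lam pp) ≤ ε lam) :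
    Negligible fun lam => 1 - (T.protocol Prep hPrep).honestOverlap lam true := by
  obtain ⟨ν, hν, hL⟩ := hT.lossy
  refine Negligible.of_abs_le ((hL.add hν.sq.abs).add (hε.abs.add hε.abs)) fun lam => ?_
  rw [abs_of_nonneg (sub_nonneg.mpr ((T.protocol Prep hPrep).honestOverlap_le_one lam true))]
  refine le_trans ?_ (le_abs_self _)
  have h := T.le_honestOverlap_protocol hPrep lam true (ε lam) (hP lam true)
  have hs : (T.genExpect lam true fun pp sp =>
      (∑ b : Bool, ∑ x, T.D lam pp x * ∑ d, T.phaseProb lam pp (T.F lam pp b x) d *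
        (T.phaseInvert lam).expect (Sum.elim sp (Sum.elim (T.F lam pp b x) d)) fun s =>
          ind (|T.wTilde lam pp (T.F lam pp b x) d false -
            (if s () then -1 else 1) * T.wTilde lam pp (T.F lam pp b x) d true| ≤ ν lam)) / 2) -
      ν lam ^ 2 / 2 ≤
      T.genExpect lam true fun pp sp => T.score lam true pp sp (T.idealState lam pp) := by
    rw [genExpect, ← RCirc.expect_const (T.gen lam) (fun _ => true) (ν lam ^ 2 / 2),
      ← RCirc.expect_sub]
    refine RCirc.expect_mono _ _ fun r => ?_
    refine (T.le_score_true lam _ _ _).trans (le_of_eq ?_)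
    beta_reduce
    rw [score]
    refine Finset.sum_congr rfl fun y _ => Finset.sum_congr rfl fun d _ => ?_
    rw [decCirc_expect _ _ _ _ _ _ fun s => overlapSq true s _]
    simp
  have e1 := le_abs_self (ε lam)
  have e2 := le_abs_self (ν lam ^ 2)
  have e3 := sq_nonneg (ν lam)
  linarith

/-- The message is `pp` alone. Security counts output 0 and indistinguishability output 1; as the
two probabilities add to 1, the advantages differ only in sign. -/
theorem secure (hT : T.IsPhaseDTCF) : (T.protocol Prep hPrep).Secure := by
  intro Adv hAdv
  refine Negligible.of_abs_le (hT.indistinguishable Adv hAdv) fun lam => le_of_eq ?_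
  have hprob : ∀ pp : Bits (Fin (T.lenPP lam)),
      (QCirc.prob (Adv lam) pp fun _ => false) = 1 - QCirc.prob (Adv lam) pp fun _ => true := by
    intro pp
    have h := QCirc.sum_prob (Adv lam) pp
    rw [← (Equiv.funUnique Unit Bool).symm.sum_comp, Fintype.sum_bool] at h
    exact eq_sub_of_add_eq' h
  have hE : ∀ b, (T.protocol Prep hPrep).senExpect lam b
      (fun msgS _ => QCirc.prob (Adv lam) msgS fun _ => false) =
      1 - T.genExpect lam b fun pp _ => QCirc.prob (Adv lam) pp fun _ => true := by
    intro b
    refine (T.senExpect_protocol hPrep lam b _).trans ?_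
    simp only [genExpect, hprob]
    rw [RCirc.expect_sub, RCirc.expect_const]
  rw [hE, hE, sub_sub_sub_cancel_left, abs_sub_comm]
  rfl

end DualModeFamily

theorem mainTheorem2 (T : DualModeFamily) (hT : T.IsPhaseDTCF) :
    ∃ P : TwoRoundProtocol, P.IsOSP := by
  obtain ⟨Prep, hPrep, ε, hε, hP⟩ := hT.preparation
  refine ⟨T.protocol Prep hPrep, fun b => ?_, DualModeFamily.secure hPrep hT⟩
  cases b
  · exact DualModeFamily.correct_false hPrep hT hε hP
  · exact DualModeFamily.correct_true hPrep hT hε hP
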